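/- Let $n\ge 1$, $1<p<\infty$ and $\frac1p<s<1+\frac1p$. Fix a dyadic Littlewood--Paley decomposition of $\mathbb{R}^n$: $(P_\lambda u)^\wedge=m_\lambda\hat u$ for $\lambda=2^k$, $k=0,1,2,\dots$, where $m_1$ is smooth with support in a ball, $m_\lambda(\xi)=m(\xi/\lambda)$ for $\lambda\ge 2$ with $m$ smooth and supported in an annulus $\{a\le|\xi|\le b\}$, $0<a\le b<\infty$, and $\sum_{\lambda\ge1} m_\lambda(\xi)=1$ for every $\xi$; write $P_{\le M}u=\sum_{1\le\lambda\le M}P_\lambda u$. Let $B^{s,p}(\mathbb{R}^n)$ be the Besov space of (complex-valued) tempered distributions $u$ with $\sum_{\lambda\ge 1}\lambda^{sp}\|P_\lambda u\|_{L^p(\mathbb{R}^n)}^p<\infty$, and for an open set $\Omega$ let $B^{s,p}(\Omega)$ be the space of restrictions to $\Omega$ of elements of $B^{s,p}(\mathbb{R}^n)$ (these are functions). Suppose that $\Omega\subset\mathbb{R}^n$ is a domain (open and connected) with Lipschitz boundary, i.e. near each of its boundary points, and in suitable orthonormal coordinates, $\Omega$ is the region above the graph of a Lipschitz function; let $\partial\Omega$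 carry the surface (that is, $(n-1)$-dimensional Hausdorff) measure. Let $f\in B^{s,p}(\Omega)$. Then $f$ has boundary values $f(y)$, determined for a.e. $y\in\partial\Omega$ by $$f(y)=\lim_{M\to\infty}P_{\le M}u(y)\quad\text{for a.e. } y\in\partial\Omega,$$ for every $u\in B^{s,p}(\mathbb{R}^n)$ whose restriction to $\Omega$ is $f$ (the limit exists a.e. and, up to null sets, does not depend on $u$). Moreover, for every $0\le\alpha<s-\frac1p$ and for a.e. $y\in\partial\Omega$ there is a constant $C=C_y$ such that $$\Big(\frac{1}{r^n}\int_{B_r(y)\cap\Omega}|f(x)-f(y)|^q\,dx\Big)^{1/q}\le C\,r^\alpha\qquad\text{for all } 0<r\le 1 \text{ and all } 1\le q\le p .$$ -/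

import Mathlib

open MeasureTheory Filter Topology
open scoped FourierTransform SchwartzMap ENNReal ContDiff NNReal

/-- A dyadic Littlewood-Paley decomposition of the frequency space `ℝⁿ`: a smooth multiplier
`low` supported in `|ξ| ≲ 1`, and a smooth multiplier `bump` supported in `|ξ| ∼ 1`, such that
`low ξ + ∑_{k ≥ 1} bump (ξ / 2 ^ k) = 1` for every `ξ`. -/
structure LittlewoodPaley (n : ℕ) where
  low : EuclideanSpace ℝ (Fin n) → ℂ
  bump : EuclideanSpace ℝ (Fin n) → ℂ
  low_smooth : ContDiff ℝ ∞ low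
  bump_smooth : ContDiff ℝ ∞ bump
  low_supp : ∃ b : ℝ, ∀ ξ, low ξ ≠ 0 → ‖ξ‖ ≤ b
  bump_supp : ∃ a b : ℝ, 0 < a ∧ ∀ ξ, bump ξ ≠ 0 → a ≤ ‖ξ‖ ∧ ‖ξ‖ ≤ b
  sum_eq_one : ∀ ξ, HasSum (fun k : ℕ ↦ bump (((2 : ℝ) ^ (k + 1))⁻¹ • ξ)) (1 - low ξ)

namespace LittlewoodPaley

variable {n : ℕ}

/-- The multiplier `m_λ` for `λ = 2 ^ k`: it is `low` for `λ = 1`, and `bump (ξ / λ)` for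
`λ ≥ 2`. -/
noncomputable def mult (P : LittlewoodPaley n) : ℕ → EuclideanSpace ℝ (Fin n) → ℂ
  | 0 => P.low
  | k + 1 => fun ξ ↦ P.bump (((2 : ℝ) ^ (k + 1))⁻¹ • ξ)

theorem mult_smooth (P : LittlewoodPaley n) (k : ℕ) : ContDiff ℝ ∞ (P.mult k) := by
  cases k with
  | zero => exact P.low_smooth
  | succ k => exact P.bump_smooth.comp (contDiff_const_smul _)

theorem mult_compact (P : LittlewoodPaley n) (k : ℕ) : HasCompactSupport (P.mult k) := by
  cases k with
  | zero =>
    obtain ⟨b, hb⟩ := P.low_supp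
    refine HasCompactSupport.intro (isCompact_closedBall 0 b) fun ξ hξ ↦ ?_
    by_contra h
    exact hξ (by simpa using hb ξ h)
  | succ k =>
    obtain ⟨a, b, -, hb⟩ := P.bump_supp
    refine HasCompactSupport.intro (isCompact_closedBall 0 (2 ^ (k + 1) * b)) fun ξ hξ ↦ ?_
    by_contra h
    refine hξ ?_
    have h1 := (hb _ h).2
    rw [norm_smul, norm_inv, norm_pow, Real.norm_ofNat, inv_mul_le_iff₀ (by positivity)] at h1
    simpa using h1

/-- The test function `ξ ↦ e ^ (2 π i ⟪x, ξ⟫) m_λ(ξ)` with `λ = 2 ^ k`. -/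
noncomputable def waveTest (P : LittlewoodPaley n) (k : ℕ) (x : EuclideanSpace ℝ (Fin n)) :
    𝓢(EuclideanSpace ℝ (Fin n), ℂ) :=
  HasCompactSupport.toSchwartzMap
    (f := fun ξ ↦ Complex.exp ((2 * Real.pi * inner ℝ x ξ : ℝ) * Complex.I) * P.mult k ξ)
    ((P.mult_compact k).mul_left)
    (((Complex.ofRealCLM.contDiff.comp
      (contDiff_const.mul (contDiff_const.inner ℝ contDiff_id))).mul contDiff_const).cexp.mul
        (P.mult_smooth k))

/-- The Littlewood-Paley projection `P_λ u`, `λ = 2 ^ k`, of a tempered distribution `u`. Since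
`m_λ` has compact support, the distribution with Fourier transform `m_λ û` is the smooth function
`x ↦ ⟨û, e ^ (2 π i ⟪x, ·⟫) m_λ⟩`; this is that function. -/
noncomputable def proj (P : LittlewoodPaley n) (k : ℕ)
    (u : 𝓢'(EuclideanSpace ℝ (Fin n), ℂ)) (x : EuclideanSpace ℝ (Fin n)) : ℂ :=
  (𝓕 u) (P.waveTest k x)

/-- `P_{≤ M} u = ∑_{1 ≤ λ ≤ M} P_λ u` for `M = 2 ^ K`. -/
noncomputable def projLE (P : LittlewoodPaley n) (K : ℕ)
    (u : 𝓢'(EuclideanSpace ℝ (Fin n), ℂ)) (x : EuclideanSpace ℝ (Fin n)) : ℂ :=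
  ∑ k ∈ Finset.range (K + 1), P.proj k u x

/-- Littlewood-Paley decompositions exist. -/
theorem nonempty (n : ℕ) : Nonempty (LittlewoodPaley n) := by
  let φ : ContDiffBump (0 : EuclideanSpace ℝ (Fin n)) := ⟨1, 2, one_pos, one_lt_two⟩
  have hφ : ContDiff ℝ ∞ (fun ξ ↦ ((φ ξ : ℝ) : ℂ)) := Complex.ofRealCLM.contDiff.comp φ.contDiff
  have h1 : ∀ ξ, ‖ξ‖ ≤ 1 → φ ξ = 1 := fun ξ h ↦
    φ.one_of_mem_closedBall (by simpa using h)
  have h2 : ∀ ξ, 2 ≤ ‖ξ‖ → φ ξ = 0 := fun ξ h ↦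
    φ.zero_of_le_dist (by simpa using h)
  refine ⟨⟨fun ξ ↦ (φ ξ : ℂ), fun ξ ↦ (φ ξ : ℂ) - (φ ((2 : ℝ) • ξ) : ℂ), hφ,
    hφ.sub (hφ.comp (contDiff_const_smul _)), ⟨2, fun ξ h ↦ ?_⟩,
    ⟨1 / 2, 2, by norm_num, fun ξ h ↦ ⟨?_, ?_⟩⟩, fun ξ ↦ ?_⟩⟩
  · by_contra hc
    exact h (by simp [h2 ξ (not_le.1 hc).le])
  · by_contra hc
    have hc' := not_le.1 hc
    refine h ?_
    rw [h1 ξ (by linarith), h1 ((2 : ℝ) • ξ) (by rw [norm_smul, Real.norm_ofNat]; linarith), sub_self]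
  · by_contra hc
    have hc' := not_le.1 hc
    refine h ?_
    rw [h2 ξ hc'.le, h2 ((2 : ℝ) • ξ) (by rw [norm_smul, Real.norm_ofNat]; linarith), sub_self]
  · have key : ∀ k : ℕ, (2 : ℝ) • ((2 : ℝ) ^ (k + 1))⁻¹ • ξ = ((2 : ℝ) ^ k)⁻¹ • ξ := fun k ↦ by
      rw [smul_smul, pow_succ]
      congr 1
      field_simp
    obtain ⟨N, hN⟩ := pow_unbounded_of_one_lt ‖ξ‖ (one_lt_two : (1 : ℝ) < 2)
    have hbig : ∀ k, N ≤ k → φ (((2 : ℝ) ^ k)⁻¹ • ξ) = 1 := fun k hk ↦ by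
      refine h1 _ ?_
      rw [norm_smul, norm_inv, norm_pow, Real.norm_ofNat, inv_mul_le_iff₀ (by positivity), mul_one]
      exact hN.le.trans (pow_le_pow_right₀ one_le_two hk)
    have hs := Finset.sum_range_sub (fun k : ℕ ↦ ((φ (((2 : ℝ) ^ k)⁻¹ • ξ) : ℝ) : ℂ)) N
    have hh := hasSum_sum_of_ne_finset_zero (s := Finset.range N) (f := fun k : ℕ ↦
      ((φ (((2 : ℝ) ^ (k + 1))⁻¹ • ξ) : ℝ) : ℂ) - ((φ (((2 : ℝ) ^ k)⁻¹ • ξ) : ℝ) : ℂ))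
      (L := SummationFilter.unconditional ℕ) (fun k hk ↦ by
        have hk' : N ≤ k := by simpa using hk
        simp [hbig k hk', hbig (k + 1) (hk'.trans k.le_succ)])
    rw [hs, hbig N le_rfl] at hh
    simpa [key] using hh

end LittlewoodPaley

/-- The Besov space `B^{s,p}(ℝⁿ)`: the tempered distributions `u` with
`∑_{λ ≥ 1} λ ^ (s p) ‖P_λ u‖_p ^ p < ∞`, the sum being over dyadic `λ`. -/
def MemBesov {n : ℕ} (P : LittlewoodPaley n) (s p : ℝ)
    (u : 𝓢'(EuclideanSpace ℝ (Fin n), ℂ)) : Prop :=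
  ∑' k : ℕ, ENNReal.ofReal (((2 : ℝ) ^ k) ^ (s * p)) *
    eLpNorm (P.proj k u) (ENNReal.ofReal p) volume ^ p < ⊤

/-- The function `f` on the open set `Ω` is the restriction to `Ω` of the distribution `u`. The
values of `f` outside `Ω` play no role. -/
def IsRestriction {n : ℕ} (Ω : Set (EuclideanSpace ℝ (Fin n)))
    (u : 𝓢'(EuclideanSpace ℝ (Fin n), ℂ)) (f : EuclideanSpace ℝ (Fin n) → ℂ) : Prop :=
  LocallyIntegrableOn f Ω volume ∧
    ∀ φ : 𝓢(EuclideanSpace ℝ (Fin n), ℂ), HasCompactSupport φ → tsupport φ ⊆ Ω →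
      u φ = ∫ x in Ω, φ x * f x

/-- The space `B^{s,p}(Ω)` of restrictions to `Ω` of elements of `B^{s,p}(ℝⁿ)`. -/
def MemBesovOn {n : ℕ} (P : LittlewoodPaley n) (s p : ℝ)
    (Ω : Set (EuclideanSpace ℝ (Fin n))) (f : EuclideanSpace ℝ (Fin n) → ℂ) : Prop :=
  ∃ u : 𝓢'(EuclideanSpace ℝ (Fin n), ℂ), MemBesov P s p u ∧ IsRestriction Ω u f

/-- `Ω` is a domain with Lipschitz boundary: an open connected set such that around each of its
boundary points there are a unit vector `ν` (the vertical direction) and a Lipschitz function `ψ`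
of the horizontal component `x - ⟪ν, x⟫ ν` for which `Ω` is, in a ball, the region above the
graph of `ψ`. -/
structure IsLipschitzDomain {n : ℕ} (Ω : Set (EuclideanSpace ℝ (Fin n))) : Prop where
  isOpen : IsOpen Ω
  isConnected : IsConnected Ω
  graph : ∀ y ∈ frontier Ω, ∃ (δ : ℝ) (ν : EuclideanSpace ℝ (Fin n)) (L : ℝ≥0)
    (ψ : EuclideanSpace ℝ (Fin n) → ℝ), 0 < δ ∧ ‖ν‖ = 1 ∧ LipschitzWith L ψ ∧
      ∀ x ∈ Metric.ball y δ, x ∈ Ω ↔ ψ (x - inner ℝ ν x • ν) < inner ℝ ν x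

/-- The surface measure of the boundary of `Ω`: the `(n - 1)`-dimensional Hausdorff measure. -/
noncomputable def boundaryMeasure {n : ℕ} (Ω : Set (EuclideanSpace ℝ (Fin n))) :
    Measure (EuclideanSpace ℝ (Fin n)) :=
  (Measure.hausdorffMeasure ((n : ℝ) - 1)).restrict (frontier Ω)

/-! Put β = s - 1/p and write P_k for the piece with λ = 2^k. The proof rests on the averages W_k(y)
= ∫ (2^{-k} + |z - y|)^{-n} |P_k u(z)|^p dz (`weightedPow`). Up to constants, W_k(y)^{1/p} bounds
|P_k u(y)|, the L^p mean of P_k u over B_r(y) for r ≥ 2^{-k}, and, with a gain 2^k |x - y| when this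
is at most 1, the increment |P_k u(x) - P_k u(y)|. The pointwise bounds
(`exists_proj_le_weightedPow`) hold because P_k u is band-limited, hence reproduced by a Schwartz
kernel at scale 2^{-k}.

Locally, a Lipschitz boundary has surface measure O(r^{n-1}) in balls of radius r, so integrating
the weight over it costs a factor 2^k. By Tonelli, ∑ 2^{k(sp-1)} W_k is integrable on ∂Ω locally,
and W_k(y)^{1/p} = O(2^{-kβ}) for a.e. y (`MemBesov.ae_exists_weightedPow_le`). The rest happens at
one such y. Since β > 0, the series ∑ P_k u(y) converges. The L^p mean of P_k u - P_k u(y) over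
B_r(y) is O(min(2^k r, 1) 2^{-kβ}), hence O((2^k r)^α 2^{-kβ}) for 0 ≤ α ≤ 1. As α < β, the sum over
k is O(r^α); the condition s < 1 + 1/p ensures α < 1.

The limit depends only on f, because Ω fills a fixed proportion of each small ball around y
(`eq_of_normalized_setLIntegral_le`). It remains to know that u is the function ∑ P_k u
(`apply_eq_integral_tsum_proj`). This requires moving a tempered distribution under an integral
sign, which is done by factoring it through a Banach space of jets (`apply_eq_integral_apply`). -/

set_option linter.unusedSectionVars false

/-! ### Derivatives of integrals depending smoothly on a parameter. -/

section ParametricIntegral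

variable {X E F : Type*} [NormedAddCommGroup X] [NormedSpace ℝ X] [NormedAddCommGroup E]
  [NormedSpace ℝ E] [NormedAddCommGroup F] [NormedSpace ℝ F]

theorem contDiff_partial_iteratedFDeriv {W : X → E → F}
    (hW : ContDiff ℝ ∞ (Function.uncurry W)) (l : ℕ) :
    ContDiff ℝ ∞ (Function.uncurry fun x ↦ iteratedFDeriv ℝ l (W x)) := by
  induction l with
  | zero =>
    have h : (Function.uncurry fun x ↦ iteratedFDeriv ℝ 0 (W x)) =
        (continuousMultilinearCurryFin0 ℝ E F).symm ∘ Function.uncurry W := by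
      ext ⟨x, y⟩
      simp [Function.uncurry]
    rw [h]
    exact (continuousMultilinearCurryFin0 ℝ E F).symm.contDiff.comp hW
  | succ l ih =>
    have h : (Function.uncurry fun x ↦ iteratedFDeriv ℝ (l + 1) (W x)) =
        (continuousMultilinearCurryLeftEquiv ℝ (fun _ : Fin (l + 1) ↦ E) F).symm ∘
          fun p : X × E ↦ fderiv ℝ (iteratedFDeriv ℝ l (W p.1)) p.2 := by
      funext ⟨x, y⟩
      simp only [Function.uncurry, iteratedFDeriv_succ_eq_comp_left, Function.comp]
    rw [h]
    let e : (E →L[ℝ] E [×l]→L[ℝ] F) ≃ₗᵢ[ℝ] E [×(l + 1)]→L[ℝ] F :=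
      (continuousMultilinearCurryLeftEquiv ℝ (fun _ : Fin (l + 1) ↦ E) F).symm
    refine ContDiff.comp (g := e) (LinearIsometryEquiv.contDiff (𝕜 := ℝ)
      (E := E →L[ℝ] E [×l]→L[ℝ] F) (F := E [×(l + 1)]→L[ℝ] F) e) ?_
    refine ContDiff.fderiv (m := ∞) (f := fun p : X × E ↦ iteratedFDeriv ℝ l (W p.1)) ?_
      contDiff_snd le_rfl
    exact ih.comp ((contDiff_fst.comp contDiff_fst).prodMk contDiff_snd)

theorem partial_iteratedFDeriv_eq_zero {W : X → E → F} {x : X} (h : ∀ ξ, W x ξ = 0) (l : ℕ) (ξ : E) :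
    iteratedFDeriv ℝ l (W x) ξ = 0 := by
  have : W x = 0 := funext h
  rw [this]
  simp

variable [MeasurableSpace X] [BorelSpace X] [SecondCountableTopology X] [ProperSpace E]

theorem integrable_of_contDiff_uncurry {W : X → E → F}
    {μ : Measure X} [IsFiniteMeasureOnCompacts μ]
    (hW : ContDiff ℝ ∞ (Function.uncurry W)) {K : Set X} (hK : IsCompact K)
    (h0 : ∀ x ∉ K, ∀ ξ, W x ξ = 0) (ξ : E) : Integrable (fun x ↦ W x ξ) μ := by
  refine Continuous.integrable_of_hasCompactSupport ?_ (HasCompactSupport.intro hK fun x hx ↦ h0 x hx ξ)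
  exact hW.continuous.comp (by fun_prop : Continuous fun x ↦ (x, ξ))

theorem hasFDerivAt_integral_of_contDiff {W : X → E → F}
    {μ : Measure X} [IsFiniteMeasureOnCompacts μ]
    (hW : ContDiff ℝ ∞ (Function.uncurry W)) {K : Set X} (hK : IsCompact K)
    (h0 : ∀ x ∉ K, ∀ ξ, W x ξ = 0) (ξ : E) :
    HasFDerivAt (fun ξ ↦ ∫ x, W x ξ ∂μ) (∫ x, fderiv ℝ (W x) ξ ∂μ) ξ := by
  have hd : Continuous fun p : X × E ↦ fderiv ℝ (W p.1) p.2 :=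
    (ContDiff.fderiv (m := ∞) (n := ∞) (f := fun p : X × E ↦ W p.1)
      (hW.comp ((contDiff_fst.comp contDiff_fst).prodMk contDiff_snd)) contDiff_snd le_rfl).continuous
  obtain ⟨C, hC⟩ := (hK.prod (isCompact_closedBall ξ 1)).exists_bound_of_continuousOn hd.continuousOn
  -- Domination is only needed near ξ: the derivative is bounded on the compact set K × closedBall ξ
  -- 1 and vanishes for x outside K.
  refine hasFDerivAt_integral_of_dominated_of_fderiv_le (s := Metric.closedBall ξ 1)
    (bound := K.indicator fun _ ↦ C) (F' := fun ξ x ↦ fderiv ℝ (W x) ξ)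
    (Metric.closedBall_mem_nhds ξ one_pos) ?_ ?_ ?_ ?_ ?_ ?_
  · exact Eventually.of_forall fun ξ ↦ (integrable_of_contDiff_uncurry hW hK h0 ξ).aestronglyMeasurable
  · exact integrable_of_contDiff_uncurry hW hK h0 ξ
  · exact (hd.comp (by fun_prop : Continuous fun x ↦ (x, ξ))).aestronglyMeasurable
  · refine Eventually.of_forall fun x η hη ↦ ?_
    by_cases hx : x ∈ K
    · simpa [hx] using hC (x, η) ⟨hx, hη⟩
    · have : W x = fun _ ↦ 0 := funext (h0 x hx)
      simp [hx, this]
  · rw [integrable_indicator_iff hK.measurableSet]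
    exact integrableOn_const hK.measure_lt_top.ne
  · refine Eventually.of_forall fun x η _ ↦ ?_
    exact ((hW.comp (contDiff_const.prodMk contDiff_id : ContDiff ℝ ∞ fun ξ : E ↦ (x, ξ))).differentiable
      (by simp)).differentiableAt.hasFDerivAt

theorem iteratedFDeriv_integral_of_contDiff {W : X → E → F} [CompleteSpace F]
    {μ : Measure X} [IsFiniteMeasureOnCompacts μ]
    (hW : ContDiff ℝ ∞ (Function.uncurry W)) {K : Set X} (hK : IsCompact K)
    (h0 : ∀ x ∉ K, ∀ ξ, W x ξ = 0) (l : ℕ) (ξ : E) :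
    iteratedFDeriv ℝ l (fun ξ ↦ ∫ x, W x ξ ∂μ) ξ = ∫ x, iteratedFDeriv ℝ l (W x) ξ ∂μ := by
  induction l generalizing ξ with
  | zero =>
    simp only [iteratedFDeriv_zero_eq_comp, Function.comp]
    exact ((continuousMultilinearCurryFin0 ℝ E F).symm.toContinuousLinearEquiv.integral_comp_comm _).symm
  | succ l ih =>
    have h1 : iteratedFDeriv ℝ l (fun ξ ↦ ∫ x, W x ξ ∂μ) = fun ξ ↦ ∫ x, iteratedFDeriv ℝ l (W x) ξ ∂μ :=
      funext ih
    simp only [iteratedFDeriv_succ_eq_comp_left, Function.comp, h1]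
    rw [(hasFDerivAt_integral_of_contDiff (μ := μ) (contDiff_partial_iteratedFDeriv hW l) hK
      (fun x hx ↦ partial_iteratedFDeriv_eq_zero (h0 x hx) l) ξ).fderiv]
    let e : (E →L[ℝ] E [×l]→L[ℝ] F) ≃ₗᵢ[ℝ] E [×(l + 1)]→L[ℝ] F :=
      (continuousMultilinearCurryLeftEquiv ℝ (fun _ : Fin (l + 1) ↦ E) F).symm
    exact (ContinuousLinearEquiv.integral_comp_comm (𝕜 := ℝ) (E := E →L[ℝ] E [×l]→L[ℝ] F)
      (F := E [×(l + 1)]→L[ℝ] F) e.toContinuousLinearEquiv (μ := μ)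
      fun x ↦ fderiv ℝ (iteratedFDeriv ℝ l (W x)) ξ).symm

end ParametricIntegral

/-! ### Tempered distributions under the integral sign. -/

section Exchange

variable {E : Type*} [NormedAddCommGroup E] [NormedSpace ℝ E] [FiniteDimensional ℝ E]

/-- Families of continuous multilinear-map-valued functions on a closed ball, of orders at
most `L`. -/
def JetSpace (E : Type*) [NormedAddCommGroup E] [NormedSpace ℝ E] (R : ℝ) (L : ℕ) : Type _ :=
  (l : Fin (L + 1)) → C(Metric.closedBall (0 : E) R, E [×l]→L[ℝ] ℂ)

noncomputable instance (R : ℝ) (L : ℕ) : NormedAddCommGroup (JetSpace E R L) :=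
  inferInstanceAs (NormedAddCommGroup
    ((l : Fin (L + 1)) → C(Metric.closedBall (0 : E) R, E [×l]→L[ℝ] ℂ)))

noncomputable instance (R : ℝ) (L : ℕ) : NormedSpace ℂ (JetSpace E R L) :=
  inferInstanceAs (NormedSpace ℂ
    ((l : Fin (L + 1)) → C(Metric.closedBall (0 : E) R, E [×l]→L[ℝ] ℂ)))

instance (R : ℝ) (L : ℕ) : CompleteSpace (JetSpace E R L) :=
  inferInstanceAs (CompleteSpace
    ((l : Fin (L + 1)) → C(Metric.closedBall (0 : E) R, E [×l]→L[ℝ] ℂ)))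

theorem JetSpace.norm_apply_le {R : ℝ} {L : ℕ} (J : JetSpace E R L) (l : Fin (L + 1))
    (ξ : Metric.closedBall (0 : E) R) : ‖J l ξ‖ ≤ ‖J‖ :=
  (ContinuousMap.norm_coe_le_norm (J l) ξ).trans
      (norm_le_pi_norm (ι := Fin (L + 1))
        (G := fun l ↦ C(Metric.closedBall (0 : E) R, E [×l]→L[ℝ] ℂ)) J l)

/-- Evaluation of a component of a jet. -/
noncomputable def JetSpace.eval (R : ℝ) (L : ℕ) (l : Fin (L + 1)) (ξ : Metric.closedBall (0 : E) R) :
    JetSpace E R L →L[ℂ] E [×l]→L[ℝ] ℂ :=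
  LinearMap.mkContinuous
    { toFun := fun J ↦ J l ξ
      map_add' := fun _ _ ↦ rfl
      map_smul' := fun _ _ ↦ rfl } 1 fun J ↦ by
    rw [one_mul]
    exact JetSpace.norm_apply_le J l ξ

theorem JetSpace.ext {R : ℝ} {L : ℕ} {J J' : JetSpace E R L} (h : ∀ l ξ, J l ξ = J' l ξ) : J = J' :=
  funext fun l ↦ ContinuousMap.ext (h l)

/-- The restrictions to a closed ball of the iterated derivatives of orders at most `L`. -/
noncomputable def jetOnBall (R : ℝ) (L : ℕ) : 𝓢(E, ℂ) →ₗ[ℂ] JetSpace E R L where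
  toFun ψ l := ⟨fun ξ ↦ iteratedFDeriv ℝ l ψ ξ,
    ((ψ.smooth ⊤).continuous_iteratedFDeriv (m := (l : ℕ)) (by exact_mod_cast le_top)).comp
      continuous_subtype_val⟩
  map_add' ψ φ := JetSpace.ext fun l ξ ↦
    iteratedFDeriv_add_apply (ψ.smooth l).contDiffAt (φ.smooth l).contDiffAt
  map_smul' c ψ := JetSpace.ext fun l ξ ↦
    iteratedFDeriv_const_smul_apply (ψ.smooth l).contDiffAt

theorem jetOnBall_apply (R : ℝ) (L : ℕ) (ψ : 𝓢(E, ℂ)) (l : Fin (L + 1))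
    (ξ : Metric.closedBall (0 : E) R) : jetOnBall R L ψ l ξ = iteratedFDeriv ℝ l ψ ξ := rfl

/-- Continuity bounds T by finitely many Schwartz seminorms. For test functions vanishing outside
the ball, the polynomial weights are at most powers of |R|, so only derivatives of bounded order on
the ball remain. -/
theorem exists_norm_apply_le_jetOnBall (T : 𝓢(E, ℂ) →L[ℂ] ℂ) (R : ℝ) :
    ∃ (L : ℕ) (C : ℝ), ∀ ψ : 𝓢(E, ℂ), (∀ ξ, R < ‖ξ‖ → ψ ξ = 0) → ‖T ψ‖ ≤ C * ‖jetOnBall R L ψ‖ := by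
  obtain ⟨s, C, -, hC⟩ := Seminorm.bound_of_continuous (schwartz_withSeminorms ℂ E ℂ)
    ((normSeminorm ℂ ℂ).comp T.toLinearMap) (continuous_norm.comp T.continuous)
  refine ⟨s.sup Prod.snd, C * ∑ i ∈ s, |R| ^ i.1, fun ψ hψ ↦ ?_⟩
  have h1 : ‖T ψ‖ ≤ C * (s.sup (schwartzSeminormFamily ℂ E ℂ)) ψ := hC ψ
  have h2 : (s.sup (schwartzSeminormFamily ℂ E ℂ)) ψ ≤
      ∑ i ∈ s, schwartzSeminormFamily ℂ E ℂ i ψ := by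
    have := Seminorm.finset_sup_le_sum (schwartzSeminormFamily ℂ E ℂ) s ψ
    simpa using this
  have h3 : ∀ i ∈ s, schwartzSeminormFamily ℂ E ℂ i ψ ≤
      |R| ^ i.1 * ‖jetOnBall R (s.sup Prod.snd) ψ‖ := by
    intro i hi
    refine SchwartzMap.seminorm_le_bound ℂ i.1 i.2 ψ (by positivity) fun ξ ↦ ?_
    rcases le_or_gt ‖ξ‖ R with h | h
    · have hl : i.2 < s.sup Prod.snd + 1 := Nat.lt_succ_of_le (Finset.le_sup (f := Prod.snd) hi)
      have h4 : ‖iteratedFDeriv ℝ i.2 ψ ξ‖ ≤ ‖jetOnBall R (s.sup Prod.snd) ψ‖ :=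
        JetSpace.norm_apply_le (jetOnBall R (s.sup Prod.snd) ψ) ⟨i.2, hl⟩ ⟨ξ, by simpa using h⟩
      gcongr
      exact h.trans (le_abs_self R)
    · have h5 : (ψ : E → ℂ) =ᶠ[𝓝 ξ] fun _ ↦ 0 := by
        filter_upwards [(isOpen_lt continuous_const continuous_norm).mem_nhds h] with η hη
        exact hψ η hη
      rw [(Filter.EventuallyEq.iteratedFDeriv ℝ h5 i.2).eq_of_nhds]
      simp only [iteratedFDeriv_fun_zero, Pi.zero_apply, norm_zero, mul_zero]
      positivity
  calc ‖T ψ‖ ≤ C * ∑ i ∈ s, |R| ^ i.1 * ‖jetOnBall R (s.sup Prod.snd) ψ‖ :=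
        h1.trans (mul_le_mul_of_nonneg_left (h2.trans (Finset.sum_le_sum h3)) C.2)
    _ = _ := by rw [← Finset.sum_mul]; ring

/-- By the preceding bound T kills every test function with zero jet, so it descends to a bounded
functional on the range of the jet map, and Hahn–Banach extends it. In the Banach space of jets
Bochner integrals commute with functionals. -/
theorem exists_apply_eq_jetOnBall (T : 𝓢(E, ℂ) →L[ℂ] ℂ) (R : ℝ) :
    ∃ (L : ℕ) (S : StrongDual ℂ (JetSpace E R L)),
      ∀ ψ : 𝓢(E, ℂ), (∀ ξ, R < ‖ξ‖ → ψ ξ = 0) → T ψ = S (jetOnBall R L ψ) := by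
  obtain ⟨L, C, hC⟩ := exists_norm_apply_le_jetOnBall T R
  let V : Submodule ℂ 𝓢(E, ℂ) :=
    { carrier := {ψ | ∀ ξ, R < ‖ξ‖ → ψ ξ = 0}
      add_mem' := fun {a b} ha hb ξ hξ ↦ by simp [ha ξ hξ, hb ξ hξ]
      zero_mem' := fun ξ _ ↦ by simp
      smul_mem' := fun c a ha ξ hξ ↦ by simp [ha ξ hξ] }
  let j := (jetOnBall R L).domRestrict V
  let t := T.toLinearMap.domRestrict V
  have hker : LinearMap.ker j ≤ LinearMap.ker t := fun ψ hψ ↦ by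
    have h1 := hC ψ ψ.2
    have h2 : jetOnBall R L (ψ : 𝓢(E, ℂ)) = 0 := hψ
    rw [h2, norm_zero, mul_zero] at h1
    exact norm_le_zero_iff.1 h1
  let f : LinearMap.range j →ₗ[ℂ] ℂ := (LinearMap.ker j).liftQ t hker ∘ₗ j.quotKerEquivRange.symm
  have hf : ∀ ψ : V, f ⟨j ψ, LinearMap.mem_range_self j ψ⟩ = T ψ := fun ψ ↦ by
    simp only [f, LinearMap.comp_apply, LinearEquiv.coe_coe]
    rw [LinearMap.quotKerEquivRange_symm_apply_image]
    simp [t]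
  obtain ⟨S, hS, -⟩ := exists_extension_norm_eq (LinearMap.range j) (f.mkContinuous C (by
    rintro ⟨_, ψ, rfl⟩
    rw [hf]
    exact hC ψ ψ.2))
  refine ⟨L, S, fun ψ hψ ↦ ?_⟩
  have := hS ⟨j ⟨ψ, hψ⟩, LinearMap.mem_range_self j _⟩
  rw [LinearMap.mkContinuous_apply, hf] at this
  exact this.symm

variable {X : Type*} [NormedAddCommGroup X] [NormedSpace ℝ X]

theorem continuous_jetOnBall {w : X → 𝓢(E, ℂ)}
    (hw : ContDiff ℝ ∞ (Function.uncurry fun x ↦ ⇑(w x))) (R : ℝ) (L : ℕ) :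
    Continuous fun x ↦ jetOnBall R L (w x) := by
  refine continuous_pi fun l ↦ ?_
  refine ContinuousMap.continuous_of_continuous_uncurry _ ?_
  exact (contDiff_partial_iteratedFDeriv hw l).continuous.comp
    (by fun_prop : Continuous fun p : X × Metric.closedBall (0 : E) R ↦ (p.1, (p.2 : E)))

theorem continuous_apply_of_contDiff_uncurry (T : 𝓢(E, ℂ) →L[ℂ] ℂ) {w : X → 𝓢(E, ℂ)}
    (hw : ContDiff ℝ ∞ (Function.uncurry fun x ↦ ⇑(w x))) {R : ℝ}
    (hR : ∀ x ξ, R < ‖ξ‖ → w x ξ = 0) : Continuous fun x ↦ T (w x) := by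
  obtain ⟨L, S, hS⟩ := exists_apply_eq_jetOnBall T R
  simp_rw [fun x ↦ hS (w x) (hR x)]
  exact S.continuous.comp (continuous_jetOnBall hw R L)

/-- A tempered distribution may be applied under the integral sign of a smooth compactly supported
family of test functions. -/
theorem apply_eq_integral_apply [MeasurableSpace X] [BorelSpace X] [SecondCountableTopology X]
    {μ : Measure X} [IsFiniteMeasureOnCompacts μ]
    (T : 𝓢(E, ℂ) →L[ℂ] ℂ) {w : X → 𝓢(E, ℂ)}
    (hw : ContDiff ℝ ∞ (Function.uncurry fun x ↦ ⇑(w x))) {R : ℝ}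
    (hR : ∀ x ξ, R < ‖ξ‖ → w x ξ = 0) {K : Set X} (hK : IsCompact K) (h0 : ∀ x ∉ K, w x = 0)
    {ψ : 𝓢(E, ℂ)} (hψ : ∀ ξ, ψ ξ = ∫ x, w x ξ ∂μ) : T ψ = ∫ x, T (w x) ∂μ := by
  obtain ⟨L, S, hS⟩ := exists_apply_eq_jetOnBall T R
  have hψ0 : ∀ ξ, R < ‖ξ‖ → ψ ξ = 0 := fun ξ hξ ↦ by
    rw [hψ]
    simp [fun x ↦ hR x ξ hξ]
  have hint : Integrable (fun x ↦ jetOnBall R L (w x)) μ :=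
    (continuous_jetOnBall hw R L).integrable_of_hasCompactSupport
      (HasCompactSupport.intro hK fun x hx ↦ by rw [h0 x hx, map_zero])
  -- Jets are compared component by component: evaluation is a bounded operator, and derivatives of
  -- ψ are computed under the integral.
  have key : jetOnBall R L ψ = ∫ x, jetOnBall R L (w x) ∂μ := by
    refine JetSpace.ext fun l ξ ↦ ?_
    have h1 : (∫ x, jetOnBall R L (w x) ∂μ) l ξ = ∫ x, jetOnBall R L (w x) l ξ ∂μ :=
      ((JetSpace.eval R L l ξ).integral_comp_comm hint).symm
    rw [h1]
    simp only [jetOnBall_apply]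
    rw [← iteratedFDeriv_integral_of_contDiff hw hK (fun x hx ξ ↦ by simp [h0 x hx])]
    congr 1
    exact funext hψ
  rw [hS ψ hψ0, key]
  simp_rw [fun x ↦ hS (w x) (hR x)]
  exact (S.integral_comp_comm hint).symm

end Exchange

/-! ### Density of compactly supported functions in the Schwartz space. -/

section Density

variable {E : Type*} [NormedAddCommGroup E] [NormedSpace ℝ E] [FiniteDimensional ℝ E]

theorem exists_schwartzMap_eq_one (R : ℝ) :
    ∃ χ : 𝓢(E, ℂ), HasCompactSupport χ ∧ ∀ x, ‖x‖ ≤ R → χ x = 1 := by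
  let φ : ContDiffBump (0 : E) := ⟨|R| + 1, |R| + 2, by positivity, by linarith⟩
  have h1 : HasCompactSupport fun x ↦ ((φ x : ℝ) : ℂ) :=
    φ.hasCompactSupport.comp_left (g := fun t : ℝ ↦ (t : ℂ)) rfl
  have h2 : ContDiff ℝ ∞ fun x ↦ ((φ x : ℝ) : ℂ) := Complex.ofRealCLM.contDiff.comp φ.contDiff
  refine ⟨h1.toSchwartzMap h2, h1, fun x hx ↦ ?_⟩
  have : φ x = 1 := φ.one_of_mem_closedBall (by
    rw [mem_closedBall_zero_iff]
    exact hx.trans ((le_abs_self R).trans (by simp [φ])))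
  simp [this]

/-- The difference vanishes where ε|x| < 1. Elsewhere 1 ≤ ε|x|, so a factor ε is bought with one
more power of |x|, which the decay of ψ pays for. -/
theorem exists_seminorm_cutoff_sub_le (χ : 𝓢(E, ℂ)) (hχ : ∀ x, ‖x‖ ≤ 1 → χ x = 1) (ψ : 𝓢(E, ℂ))
    (k l : ℕ) : ∃ C : ℝ, ∀ ε : ℝ, 0 < ε → ε ≤ 1 → ∀ ψ' : 𝓢(E, ℂ), (∀ x, ψ' x = χ (ε • x) * ψ x) →
      SchwartzMap.seminorm ℂ k l (ψ' - ψ) ≤ C * ε := by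
  refine ⟨∑ i ∈ Finset.range (l + 1), l.choose i * SchwartzMap.seminorm ℂ 0 i χ *
    SchwartzMap.seminorm ℂ (k + 1) (l - i) ψ + SchwartzMap.seminorm ℂ (k + 1) l ψ,
    fun ε hε hε1 ψ' hψ' ↦ ?_⟩
  refine SchwartzMap.seminorm_le_bound ℂ k l _ (by positivity) fun x ↦ ?_
  have hsmooth : ContDiff ℝ l fun x ↦ χ (ε • x) := (χ.smooth l).comp (contDiff_const_smul ε)
  rcases lt_or_ge (ε * ‖x‖) 1 with h | h
  · have h5 : (ψ' - ψ : E → ℂ) =ᶠ[𝓝 x] fun _ ↦ 0 := by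
      filter_upwards [(isOpen_lt (continuous_const.mul continuous_norm) continuous_const).mem_nhds h]
        with η hη
      have : ‖ε • η‖ ≤ 1 := by
        rw [norm_smul, Real.norm_of_nonneg hε.le]
        exact le_of_lt hη
      simp [hψ', hχ _ this]
    have h6 : iteratedFDeriv ℝ l (ψ' - ψ : 𝓢(E, ℂ)) x = 0 := by
      refine (Filter.EventuallyEq.iteratedFDeriv ℝ h5 l).eq_of_nhds.trans ?_
      simp
    rw [h6, norm_zero, mul_zero]
    positivity
  · have h1 : iteratedFDeriv ℝ l (ψ' - ψ : 𝓢(E, ℂ)) x =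
        iteratedFDeriv ℝ l (fun x ↦ χ (ε • x) * ψ x) x - iteratedFDeriv ℝ l ψ x := by
      have h2 : ((ψ' - ψ : 𝓢(E, ℂ)) : E → ℂ) = (fun x ↦ χ (ε • x) * ψ x) - ψ := by
        ext y
        simp [hψ']
      rw [h2, iteratedFDeriv_sub_apply (hsmooth.mul (ψ.smooth l)).contDiffAt (ψ.smooth l).contDiffAt]
    have h2 : ‖iteratedFDeriv ℝ l (fun x ↦ χ (ε • x) * ψ x) x‖ ≤
        ∑ i ∈ Finset.range (l + 1), l.choose i * SchwartzMap.seminorm ℂ 0 i χ *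
          ‖iteratedFDeriv ℝ (l - i) ψ x‖ := by
      refine (norm_iteratedFDeriv_mul_le hsmooth (ψ.smooth l) x le_rfl).trans ?_
      refine Finset.sum_le_sum fun i hi ↦ ?_
      gcongr
      rw [iteratedFDeriv_comp_const_smul ε (χ.smooth i), norm_smul, norm_pow,
        Real.norm_of_nonneg hε.le]
      calc _ ≤ 1 * SchwartzMap.seminorm ℂ 0 i χ := by
            gcongr
            · exact pow_le_one₀ hε.le hε1
            · exact χ.norm_iteratedFDeriv_le_seminorm ℂ i _
        _ = _ := one_mul _
    have h3 : ‖x‖ ^ k ≤ ε * ‖x‖ ^ (k + 1) := by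
      rw [pow_succ']
      nlinarith [pow_nonneg (norm_nonneg x) k]
    calc ‖x‖ ^ k * ‖iteratedFDeriv ℝ l (ψ' - ψ : 𝓢(E, ℂ)) x‖
        ≤ (ε * ‖x‖ ^ (k + 1)) * (∑ i ∈ Finset.range (l + 1), l.choose i *
            SchwartzMap.seminorm ℂ 0 i χ * ‖iteratedFDeriv ℝ (l - i) ψ x‖ +
              ‖iteratedFDeriv ℝ l ψ x‖) := by
          rw [h1]
          gcongr
          exact (norm_sub_le _ _).trans (add_le_add_left h2 _)
      _ = (∑ i ∈ Finset.range (l + 1), l.choose i * SchwartzMap.seminorm ℂ 0 i χ *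
            (‖x‖ ^ (k + 1) * ‖iteratedFDeriv ℝ (l - i) ψ x‖) +
              ‖x‖ ^ (k + 1) * ‖iteratedFDeriv ℝ l ψ x‖) * ε := by
          have : ∀ i ∈ Finset.range (l + 1), l.choose i * SchwartzMap.seminorm ℂ 0 i χ *
            (‖x‖ ^ (k + 1) * ‖iteratedFDeriv ℝ (l - i) ψ x‖) = ‖x‖ ^ (k + 1) * (l.choose i *
              SchwartzMap.seminorm ℂ 0 i χ * ‖iteratedFDeriv ℝ (l - i) ψ x‖) := fun i _ ↦ by ring
          rw [Finset.sum_congr rfl this, ← Finset.mul_sum]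
          ring
      _ ≤ _ := by
          gcongr
          · exact ψ.le_seminorm ℂ _ _ x
          · exact ψ.le_seminorm ℂ _ _ x

theorem SchwartzMap.dense_hasCompactSupport : Dense {ψ : 𝓢(E, ℂ) | HasCompactSupport ψ} := by
  intro ψ
  obtain ⟨χ, hχc, hχ⟩ := exists_schwartzMap_eq_one (E := E) 1
  have hc : ∀ N : ℕ, HasCompactSupport fun x ↦ χ ((1 / (N + 1 : ℝ)) • x) * ψ x := fun N ↦
    (hχc.comp_smul (by positivity)).mul_right
  let u : ℕ → 𝓢(E, ℂ) := fun N ↦ (hc N).toSchwartzMap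
    (((χ.smooth ⊤).comp (contDiff_const_smul _)).mul (ψ.smooth ⊤))
  refine mem_closure_of_tendsto (f := u) (b := atTop) ?_ (Eventually.of_forall hc)
  rw [(schwartz_withSeminorms ℂ E ℂ).tendsto_nhds]
  rintro ⟨k, l⟩ δ hδ
  obtain ⟨C, hC⟩ := exists_seminorm_cutoff_sub_le χ hχ ψ k l
  have ht : Tendsto (fun N : ℕ ↦ C * (1 / ((N : ℝ) + 1))) atTop (𝓝 0) := by
    simpa using tendsto_one_div_add_atTop_nhds_zero_nat.const_mul C
  filter_upwards [ht.eventually (gt_mem_nhds hδ)] with N hN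
  refine lt_of_le_of_lt (hC (1 / (N + 1 : ℝ)) (by positivity) ?_ (u N) fun x ↦ rfl) hN
  rw [div_le_one (by positivity)]
  linarith [(Nat.cast_nonneg N : (0 : ℝ) ≤ N)]

theorem SchwartzMap.continuousLinearMap_ext_of_hasCompactSupport {S T : 𝓢(E, ℂ) →L[ℂ] ℂ}
    (h : ∀ ψ : 𝓢(E, ℂ), HasCompactSupport ψ → S ψ = T ψ) : S = T :=
  ContinuousLinearMap.ext fun ψ ↦ congrFun
    (S.continuous.ext_on SchwartzMap.dense_hasCompactSupport T.continuous h) ψ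

end Density

/-! ### Littlewood–Paley pieces as functions and as distributions. -/

namespace LittlewoodPaley

variable {n : ℕ}

theorem waveTest_apply (P : LittlewoodPaley n) (k : ℕ) (x ξ : EuclideanSpace ℝ (Fin n)) :
    P.waveTest k x ξ =
      Complex.exp ((2 * Real.pi * inner ℝ x ξ : ℝ) * Complex.I) * P.mult k ξ := rfl

theorem exists_radius (P : LittlewoodPaley n) :
    ∃ R : ℝ, ∀ k ξ, P.mult k ξ ≠ 0 → ‖((2 : ℝ) ^ k)⁻¹ • ξ‖ ≤ R := by
  obtain ⟨b, hb⟩ := P.low_supp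
  obtain ⟨a, b', -, hb'⟩ := P.bump_supp
  refine ⟨max b b', fun k ξ h ↦ ?_⟩
  cases k with
  | zero => simpa using Or.inl (hb ξ h)
  | succ k => exact (hb' _ h).2.trans (le_max_right _ _)

theorem exists_mult_eq_zero (P : LittlewoodPaley n) (k : ℕ) :
    ∃ R : ℝ, ∀ ξ, R < ‖ξ‖ → P.mult k ξ = 0 := by
  obtain ⟨R, hR⟩ := P.exists_radius
  refine ⟨2 ^ k * R, fun ξ hξ ↦ ?_⟩
  by_contra h
  have := hR k ξ h
  rw [norm_smul, norm_inv, norm_pow, Real.norm_ofNat, inv_mul_le_iff₀ (by positivity)] at this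
  linarith

theorem contDiff_smul_waveTest (P : LittlewoodPaley n) (k : ℕ)
    (h : 𝓢(EuclideanSpace ℝ (Fin n), ℂ)) :
    ContDiff ℝ ∞ (Function.uncurry fun x ↦ ⇑(h x • P.waveTest k x)) := by
  have h1 : (Function.uncurry fun x ↦ ⇑(h x • P.waveTest k x)) =
      fun p : EuclideanSpace ℝ (Fin n) × EuclideanSpace ℝ (Fin n) ↦ h p.1 *
        (Complex.exp ((2 * Real.pi * inner ℝ p.1 p.2 : ℝ) * Complex.I) * P.mult k p.2) := by
    ext p
    simp [Function.uncurry, waveTest_apply]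
  rw [h1]
  refine ((h.smooth ⊤).comp contDiff_fst).mul
    (((Complex.ofRealCLM.contDiff.comp ?_).mul contDiff_const).cexp.mul
      ((P.mult_smooth k).comp contDiff_snd))
  exact contDiff_const.mul (contDiff_fst.inner ℝ contDiff_snd)

theorem continuous_proj (P : LittlewoodPaley n) (k : ℕ) (u : 𝓢'(EuclideanSpace ℝ (Fin n), ℂ)) :
    Continuous (P.proj k u) := by
  obtain ⟨R, hR⟩ := P.exists_mult_eq_zero k
  refine continuous_iff_continuousAt.2 fun x₀ ↦ ?_
  -- Continuity is local: χ is 1 near x₀, so multiplying the family by χ x changes nothing there.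
  obtain ⟨χ, -, hχ⟩ := exists_schwartzMap_eq_one (E := EuclideanSpace ℝ (Fin n)) (‖x₀‖ + 1)
  have h1 := continuous_apply_of_contDiff_uncurry (𝓕 u : 𝓢(EuclideanSpace ℝ (Fin n), ℂ) →L[ℂ] ℂ)
    (P.contDiff_smul_waveTest k χ) (R := R) (fun x ξ hξ ↦ by simp [waveTest_apply, hR ξ hξ])
  refine h1.continuousAt.congr ?_
  filter_upwards [(isOpen_lt continuous_norm continuous_const).mem_nhds
    (show ‖x₀‖ < ‖x₀‖ + 1 by linarith)] with x hx
  rw [hχ x (le_of_lt hx), one_smul]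
  rfl

theorem fourierInv_apply_eq_integral (h : 𝓢(EuclideanSpace ℝ (Fin n), ℂ))
    (ξ : EuclideanSpace ℝ (Fin n)) : 𝓕⁻ h ξ =
      ∫ x, Complex.exp ((2 * Real.pi * inner ℝ x ξ : ℝ) * Complex.I) * h x := by
  rw [SchwartzMap.fourierInv_coe, Real.fourierInv_eq']
  simp

/-- The inverse Fourier integral writes m_λ 𝓕⁻h as a superposition of the test functions `waveTest`
with weights h(x). For h of compact support the distribution passes under this integral. -/
theorem apply_mult_fourierInv_of_hasCompactSupport (P : LittlewoodPaley n) (k : ℕ)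
    (u : 𝓢'(EuclideanSpace ℝ (Fin n), ℂ)) {h : 𝓢(EuclideanSpace ℝ (Fin n), ℂ)}
    (hh : HasCompactSupport h) :
    (𝓕 u) (SchwartzMap.smulLeftCLM ℂ (P.mult k) (𝓕⁻ h)) = ∫ x, h x • P.proj k u x := by
  obtain ⟨R, hR⟩ := P.exists_mult_eq_zero k
  refine (apply_eq_integral_apply (μ := volume) (𝓕 u : 𝓢(EuclideanSpace ℝ (Fin n), ℂ) →L[ℂ] ℂ)
    (P.contDiff_smul_waveTest k h) (R := R) (fun x ξ hξ ↦ by simp [waveTest_apply, hR ξ hξ])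
    hh (fun x hx ↦ by simp [image_eq_zero_of_notMem_tsupport hx]) fun ξ ↦ ?_).trans ?_
  · rw [SchwartzMap.smulLeftCLM_apply_apply
      ((P.mult_compact k).hasTemperateGrowth (P.mult_smooth k)), fourierInv_apply_eq_integral,
      smul_eq_mul, ← integral_const_mul]
    refine integral_congr_ae (Eventually.of_forall fun x ↦ ?_)
    simp only [smul_apply, waveTest_apply, smul_eq_mul]
    ring
  · refine integral_congr_ae (Eventually.of_forall fun x ↦ ?_)
    exact map_smul (𝓕 u : 𝓢(EuclideanSpace ℝ (Fin n), ℂ) →L[ℂ] ℂ) _ _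

/-- `P_λ u` represents the distribution with Fourier transform `m_λ û`. -/
theorem apply_mult_fourierInv (P : LittlewoodPaley n) (k : ℕ)
    (u : 𝓢'(EuclideanSpace ℝ (Fin n), ℂ)) {q : ℝ≥0∞} (hq : 1 ≤ q)
    (hu : MemLp (P.proj k u) q) (h : 𝓢(EuclideanSpace ℝ (Fin n), ℂ)) :
    (𝓕 u) (SchwartzMap.smulLeftCLM ℂ (P.mult k) (𝓕⁻ h)) = ∫ x, h x • P.proj k u x := by
  have : Fact (1 ≤ q) := ⟨hq⟩
  have hR : ∀ h : 𝓢(EuclideanSpace ℝ (Fin n), ℂ),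
      Lp.toTemperedDistribution (hu.toLp _) h = ∫ x, h x • P.proj k u x := fun h ↦ by
    rw [Lp.toTemperedDistribution_apply]
    refine integral_congr_ae ?_
    filter_upwards [hu.coeFn_toLp] with x hx
    rw [hx]
  -- Once P_λ u is in L^q, both sides are continuous in h, so compactly supported h suffice.
  have key := SchwartzMap.continuousLinearMap_ext_of_hasCompactSupport
    (S := (𝓕 u : 𝓢(EuclideanSpace ℝ (Fin n), ℂ) →L[ℂ] ℂ) ∘L
      SchwartzMap.smulLeftCLM ℂ (P.mult k) ∘L
        FourierTransform.fourierInvCLM ℂ 𝓢(EuclideanSpace ℝ (Fin n), ℂ))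
    (T := (Lp.toTemperedDistribution (hu.toLp _) : 𝓢(EuclideanSpace ℝ (Fin n), ℂ) →L[ℂ] ℂ))
    fun h hh ↦ (P.apply_mult_fourierInv_of_hasCompactSupport k u hh).trans (hR h).symm
  exact (congrArg (fun S : 𝓢(EuclideanSpace ℝ (Fin n), ℂ) →L[ℂ] ℂ ↦ S h) key).trans (hR h)

end LittlewoodPaley

/-! ### Absolutely convergent series in L^p. -/

section LpSums

variable {α : Type*} [MeasurableSpace α] {μ : Measure α}

/-- Minkowski's inequality for countable sums. -/
theorem lintegral_Lp_tsum_le {F : ℕ → α → ℝ≥0∞} (hF : ∀ k, AEMeasurable (F k) μ) {p : ℝ}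
    (hp : 1 ≤ p) : (∫⁻ x, (∑' k, F k x) ^ p ∂μ) ^ (1 / p) ≤ ∑' k, (∫⁻ x, F k x ^ p ∂μ) ^ (1 / p) := by
  have hp0 : 0 < p := one_pos.trans_le hp
  have hfin : ∀ N, (∫⁻ x, (∑ k ∈ Finset.range N, F k x) ^ p ∂μ) ^ (1 / p) ≤
      ∑ k ∈ Finset.range N, (∫⁻ x, F k x ^ p ∂μ) ^ (1 / p) := by
    intro N
    induction N with
    | zero => simp [hp0]
    | succ N ih =>
      simp only [Finset.sum_range_succ]
      refine (ENNReal.lintegral_Lp_add_le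
        (Finset.aemeasurable_fun_sum _ fun k _ ↦ hF k) (hF N) hp).trans ?_
      gcongr
  have h1 : ∀ x, (∑' k, F k x) ^ p = ⨆ N, (∑ k ∈ Finset.range N, F k x) ^ p := fun x ↦ by
    rw [ENNReal.tsum_eq_iSup_nat]
    exact (ENNReal.orderIsoRpow p hp0).map_iSup _
  -- Monotone convergence passes from the partial sums to the series.
  have h2 : ∫⁻ x, (∑' k, F k x) ^ p ∂μ ≤ (∑' k, (∫⁻ x, F k x ^ p ∂μ) ^ (1 / p)) ^ p := by
    simp_rw [h1]
    rw [lintegral_iSup' (fun N ↦ (Finset.aemeasurable_fun_sum _ fun k _ ↦ hF k).pow_const p)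
      (Eventually.of_forall fun x N M hNM ↦ ENNReal.rpow_le_rpow
        (Finset.sum_le_sum_of_subset (Finset.range_mono hNM)) hp0.le)]
    refine iSup_le fun N ↦ ?_
    have := (hfin N).trans (ENNReal.sum_le_tsum _)
    rwa [one_div, ENNReal.rpow_inv_le_iff hp0, ← one_div] at this
  rwa [one_div, ENNReal.rpow_inv_le_iff hp0, ← one_div]

theorem eLpNorm_ofReal_eq_lintegral {F : Type*} [NormedAddCommGroup F] {p : ℝ} (hp : 0 < p)
    (f : α → F) : eLpNorm f (ENNReal.ofReal p) μ = (∫⁻ x, ‖f x‖ₑ ^ p ∂μ) ^ (1 / p) := by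
  rw [eLpNorm_eq_lintegral_rpow_enorm_toReal (by simpa using hp) ENNReal.ofReal_ne_top,
    ENNReal.toReal_ofReal hp.le]

variable {g : ℕ → α → ℂ} {p : ℝ}

theorem lintegral_tsum_enorm_rpow_lt_top (hp : 1 ≤ p) (hg : ∀ k, AEStronglyMeasurable (g k) μ)
    (hsum : ∑' k, eLpNorm (g k) (ENNReal.ofReal p) μ < ⊤) :
    ∫⁻ x, (∑' k, ‖g k x‖ₑ) ^ p ∂μ < ⊤ := by
  have hp0 : 0 < p := one_pos.trans_le hp
  have h1 := lintegral_Lp_tsum_le (fun k ↦ (hg k).enorm) hp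
  simp_rw [← eLpNorm_ofReal_eq_lintegral hp0] at h1
  exact (ENNReal.rpow_lt_top_iff_of_pos (by positivity)).1 (h1.trans_lt hsum)

theorem ae_tsum_enorm_lt_top (hp : 1 ≤ p) (hg : ∀ k, AEStronglyMeasurable (g k) μ)
    (hsum : ∑' k, eLpNorm (g k) (ENNReal.ofReal p) μ < ⊤) :
    ∀ᵐ x ∂μ, ∑' k, ‖g k x‖ₑ < ⊤ := by
  filter_upwards [ae_lt_top' ((AEMeasurable.tsum fun k ↦ (hg k).enorm).pow_const p)
    (lintegral_tsum_enorm_rpow_lt_top hp hg hsum).ne] with x hx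
  exact (ENNReal.rpow_lt_top_iff_of_pos (one_pos.trans_le hp)).1 hx

theorem memLp_tsum (hp : 1 ≤ p) (hg : ∀ k, AEStronglyMeasurable (g k) μ)
    (hsum : ∑' k, eLpNorm (g k) (ENNReal.ofReal p) μ < ⊤) :
    MemLp (fun x ↦ ∑' k, g k x) (ENNReal.ofReal p) μ := by
  have hp0 : 0 < p := one_pos.trans_le hp
  refine ⟨?_, ?_⟩
  · refine aestronglyMeasurable_of_tendsto_ae (u := atTop)
      (f := fun N x ↦ ∑ k ∈ Finset.range N, g k x)
      (fun N ↦ Finset.aestronglyMeasurable_fun_sum _ fun k _ ↦ hg k) ?_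
    filter_upwards [ae_tsum_enorm_lt_top hp hg hsum] with x hx
    exact (Summable.of_enorm hx.ne).hasSum.tendsto_sum_nat
  · rw [eLpNorm_ofReal_eq_lintegral hp0]
    refine ENNReal.rpow_lt_top_of_nonneg (by positivity) (lt_of_le_of_lt ?_
      (lintegral_tsum_enorm_rpow_lt_top hp hg hsum)).ne
    gcongr
    exact enorm_tsum_le_tsum_enorm

theorem hasSum_integral_mul_of_tsum_eLpNorm_lt_top (hp : 1 < p)
    (hg : ∀ k, AEStronglyMeasurable (g k) μ)
    (hsum : ∑' k, eLpNorm (g k) (ENNReal.ofReal p) μ < ⊤) {h : α → ℂ}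
    (hh : ∀ q : ℝ≥0∞, MemLp h q μ) :
    HasSum (fun k ↦ ∫ x, h x * g k x ∂μ) (∫ x, h x * ∑' k, g k x ∂μ) := by
  have hp0 : 0 < p := one_pos.trans hp
  have hpq : p.HolderConjugate (p / (p - 1)) := Real.HolderConjugate.conjExponent hp
  set q := p / (p - 1)
  have hb : ∀ k, ∫⁻ x, ‖h x * g k x‖ₑ ∂μ ≤
      (∫⁻ x, ‖h x‖ₑ ^ q ∂μ) ^ (1 / q) * eLpNorm (g k) (ENNReal.ofReal p) μ := fun k ↦ by
    rw [eLpNorm_ofReal_eq_lintegral hp0]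
    simp_rw [enorm_mul]
    exact ENNReal.lintegral_mul_le_Lp_mul_Lq μ hpq.symm (hh 1).1.enorm (hg k).enorm
  have hq : (∫⁻ x, ‖h x‖ₑ ^ q ∂μ) ^ (1 / q) < ⊤ := by
    rw [← eLpNorm_ofReal_eq_lintegral hpq.symm.pos]
    exact (hh _).2
  have hfin : ∑' k, ∫⁻ x, ‖h x * g k x‖ₑ ∂μ < ⊤ := by
    refine (ENNReal.tsum_le_tsum hb).trans_lt ?_
    rw [ENNReal.tsum_mul_left]
    exact ENNReal.mul_lt_top hq hsum
  have hint : ∀ k, Integrable (fun x ↦ h x * g k x) μ := fun k ↦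
    ⟨(hh 1).1.mul (hg k), (ENNReal.le_tsum k).trans_lt hfin⟩
  simp_rw [← tsum_mul_left]
  refine hasSum_integral_of_summable_integral_norm hint ?_
  have h2 : ∀ k, ∫ x, ‖h x * g k x‖ ∂μ = (∫⁻ x, ‖h x * g k x‖ₑ ∂μ).toReal := fun k ↦
    integral_norm_eq_lintegral_enorm (hint k).1
  simp_rw [h2]
  exact ENNReal.summable_toReal hfin.ne

end LpSums

/-! ### A Besov distribution is the sum of its pieces. -/

namespace LittlewoodPaley

variable {n : ℕ}

/-- The annulus carrying `bump` stays away from 0, so only finitely many multipliers meet a given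
ball. -/
theorem exists_sum_mult_eq_one (P : LittlewoodPaley n) (R : ℝ) :
    ∃ N : ℕ, ∀ K, N ≤ K → ∀ ξ, ‖ξ‖ ≤ R → ∑ k ∈ Finset.range K, P.mult k ξ = 1 := by
  obtain ⟨a, b, ha, hab⟩ := P.bump_supp
  obtain ⟨N, hN⟩ := pow_unbounded_of_one_lt (R / a) (one_lt_two : (1 : ℝ) < 2)
  refine ⟨N + 1, fun K hK ξ hξ ↦ ?_⟩
  obtain ⟨K, rfl⟩ : ∃ K', K = K' + 1 := ⟨K - 1, by omega⟩
  have h1 : ∀ k, K ≤ k → P.bump (((2 : ℝ) ^ (k + 1))⁻¹ • ξ) = 0 := fun k hk ↦ by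
    by_contra h
    have h2 := (hab _ h).1
    rw [norm_smul, norm_inv, norm_pow, Real.norm_ofNat, le_inv_mul_iff₀ (by positivity)] at h2
    have h3 : (2 : ℝ) ^ N ≤ 2 ^ (k + 1) := pow_le_pow_right₀ one_le_two (by omega)
    rw [div_lt_iff₀ ha] at hN
    nlinarith
  have h2 := (P.sum_eq_one ξ).unique (hasSum_sum_of_ne_finset_zero (s := Finset.range K)
    fun k hk ↦ h1 k (by simpa using hk))
  rw [Finset.sum_range_succ']
  simp only [mult]
  rw [← h2]
  ring

/-- By density it suffices to test against Fourier transforms of compactly supported θ. On the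
support of θ finitely many multipliers already sum to 1, so the partial sums are eventually equal to
û(θ). -/
theorem apply_eq_integral_tsum_proj (P : LittlewoodPaley n) {p : ℝ} (hp : 1 < p)
    (u : 𝓢'(EuclideanSpace ℝ (Fin n), ℂ))
    (hu : ∑' k, eLpNorm (P.proj k u) (ENNReal.ofReal p) volume < ⊤)
    (h : 𝓢(EuclideanSpace ℝ (Fin n), ℂ)) : u h = ∫ x, h x * ∑' k, P.proj k u x := by
  have hg : ∀ k, AEStronglyMeasurable (P.proj k u) volume := fun k ↦
    (P.continuous_proj k u).aestronglyMeasurable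
  have hU := memLp_tsum hp.le hg hu
  have hq : 1 ≤ ENNReal.ofReal p := by simpa using hp.le
  have : Fact (1 ≤ ENNReal.ofReal p) := ⟨hq⟩
  have hR : ∀ h : 𝓢(EuclideanSpace ℝ (Fin n), ℂ),
      Lp.toTemperedDistribution (hU.toLp _) h = ∫ x, h x * ∑' k, P.proj k u x := fun h ↦ by
    rw [Lp.toTemperedDistribution_apply]
    refine integral_congr_ae ?_
    filter_upwards [hU.coeFn_toLp] with x hx
    rw [hx, smul_eq_mul]
  have hgk : ∀ k, MemLp (P.proj k u) (ENNReal.ofReal p) := fun k ↦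
    ⟨hg k, (ENNReal.le_tsum k).trans_lt hu⟩
  let FT := FourierTransform.fourierCLM ℂ 𝓢(EuclideanSpace ℝ (Fin n), ℂ)
  have key := SchwartzMap.continuousLinearMap_ext_of_hasCompactSupport
    (S := (u : 𝓢(EuclideanSpace ℝ (Fin n), ℂ) →L[ℂ] ℂ) ∘L FT)
    (T := (Lp.toTemperedDistribution (hU.toLp _) : 𝓢(EuclideanSpace ℝ (Fin n), ℂ) →L[ℂ] ℂ) ∘L FT)
    (by
      intro θ hθ
      refine Eq.trans ?_ (hR (𝓕 θ)).symm
      change (𝓕 u) θ = _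
      obtain ⟨R, hR⟩ := hθ.isCompact.isBounded.exists_norm_le
      obtain ⟨N, hN⟩ := P.exists_sum_mult_eq_one R
      refine tendsto_nhds_unique (tendsto_const_nhds.congr' ?_)
        (hasSum_integral_mul_of_tsum_eLpNorm_lt_top hp hg hu
          fun q ↦ (𝓕 θ).memLp q).tendsto_sum_nat
      filter_upwards [eventually_ge_atTop N] with K hK
      have h1 : θ = ∑ k ∈ Finset.range K, SchwartzMap.smulLeftCLM ℂ (P.mult k) θ := by
        ext ξ
        simp only [sum_apply, SchwartzMap.smulLeftCLM_apply_apply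
          ((P.mult_compact _).hasTemperateGrowth (P.mult_smooth _)), smul_eq_mul]
        rw [← Finset.sum_mul]
        by_cases h0 : ξ ∈ tsupport θ
        · rw [hN K hK ξ (hR ξ h0), one_mul]
        · rw [image_eq_zero_of_notMem_tsupport h0, mul_zero]
      conv_lhs => rw [h1]
      refine (map_sum (𝓕 u : 𝓢(EuclideanSpace ℝ (Fin n), ℂ) →L[ℂ] ℂ) _ _).trans ?_
      refine Finset.sum_congr rfl fun k _ ↦ ?_
      have h2 := P.apply_mult_fourierInv k u hq (hgk k) (𝓕 θ)
      rw [FourierTransform.fourierInv_fourier_eq] at h2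
      exact h2)
  have h3 : u (FT (𝓕⁻ h)) = Lp.toTemperedDistribution (hU.toLp _) (FT (𝓕⁻ h)) :=
    congrArg (fun S : 𝓢(EuclideanSpace ℝ (Fin n), ℂ) →L[ℂ] ℂ ↦ S (𝓕⁻ h)) key
  have h4 : FT (𝓕⁻ h) = h := by
    simp only [FT, FourierTransform.fourierCLM_apply, FourierTransform.fourier_fourierInv_eq]
  rw [h4] at h3
  exact h3.trans (hR h)

end LittlewoodPaley

theorem IsRestriction.ae_eq {n : ℕ} {Ω : Set (EuclideanSpace ℝ (Fin n))} (hΩ : IsOpen Ω)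
    {u : 𝓢'(EuclideanSpace ℝ (Fin n), ℂ)} {f U : EuclideanSpace ℝ (Fin n) → ℂ}
    (hf : IsRestriction Ω u f) (hU : LocallyIntegrable U)
    (huU : ∀ h : 𝓢(EuclideanSpace ℝ (Fin n), ℂ), u h = ∫ x, h x * U x) :
    ∀ᵐ x, x ∈ Ω → f x = U x := by
  have hfU : LocallyIntegrableOn (fun x ↦ f x - U x) Ω := hf.1.sub (hU.locallyIntegrableOn Ω)
  have key := hΩ.ae_eq_zero_of_integral_contDiff_smul_eq_zero hfU fun g hg hgc hgs ↦ by
    have hc : HasCompactSupport fun x ↦ (g x : ℂ) := hgc.comp_left (g := fun t : ℝ ↦ (t : ℂ)) rfl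
    have hs : ContDiff ℝ ∞ fun x ↦ (g x : ℂ) := Complex.ofRealCLM.contDiff.comp hg
    have hsupp : tsupport (fun x ↦ (g x : ℂ)) ⊆ tsupport g :=
      closure_mono fun x hx ↦ by simpa using hx
    have h1 := hf.2 (hc.toSchwartzMap hs) hc (hsupp.trans hgs)
    rw [huU] at h1
    simp only [HasCompactSupport.toSchwartzMap_toFun] at h1
    have h0 : ∀ x ∉ tsupport g, g x = 0 := fun x hx ↦ image_eq_zero_of_notMem_tsupport hx
    have hi : ∀ v : EuclideanSpace ℝ (Fin n) → ℂ, LocallyIntegrableOn v Ω →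
        Integrable fun x ↦ (g x : ℂ) * v x := fun v hv ↦ by
      have h2 := (hv.integrableOn_compact_subset hgs hgc).continuousOn_mul
        (hs.continuous.continuousOn) hgc
      refine (integrableOn_iff_integrable_of_support_subset fun x hx ↦ ?_).1 h2
      by_contra hx'
      simp [h0 x hx'] at hx
    have h3 : ∫ x in Ω, (g x : ℂ) * f x = ∫ x, (g x : ℂ) * f x :=
      setIntegral_eq_integral_of_forall_compl_eq_zero fun x hx ↦ by
        simp [h0 x fun h ↦ hx (hgs h)]
    calc ∫ x, g x • (f x - U x) = ∫ x, ((g x : ℂ) * f x - (g x : ℂ) * U x) := by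
          refine integral_congr_ae (Eventually.of_forall fun x ↦ ?_)
          simp [mul_sub]
      _ = 0 := by
          rw [integral_sub (hi f hf.1) (hi U (hU.locallyIntegrableOn Ω)), ← h3]
          exact sub_eq_zero.2 h1.symm
  filter_upwards [key] with x hx hxΩ
  exact sub_eq_zero.1 (hx hxΩ)

/-! ### Weighted averages and kernel estimates. -/

/-- If balls of radius `r` around `y` have measure at most `C r ^ d`, then
`∫ (ρ + |z - y|) ^ (-d - 1)` is `O(1 / ρ)`. -/
theorem lintegral_inv_add_dist_pow_le {X : Type*} [PseudoMetricSpace X] [MeasurableSpace X]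
    [OpensMeasurableSpace X] {τ : Measure X} {y : X} {d : ℕ} {C : ℝ} (hC : 0 ≤ C)
    (hτ : ∀ r : ℝ, 0 < r → τ (Metric.ball y r) ≤ ENNReal.ofReal (C * r ^ d)) {ρ : ℝ} (hρ : 0 < ρ) :
    ∫⁻ z, ENNReal.ofReal ((ρ + dist z y) ^ (d + 1))⁻¹ ∂τ ≤ ENNReal.ofReal (2 ^ (d + 2) * C / ρ) := by
  -- Dyadic decomposition: for the least m with |z - y| < 2^m ρ one has ρ + |z - y| ≥ 2^m ρ / 2. The
  -- m-th ball then contributes 2^{d+1} C / (2^m ρ), and the geometric series adds the last factor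
  -- 2.
  have hpt : ∀ z, ENNReal.ofReal ((ρ + dist z y) ^ (d + 1))⁻¹ ≤
      ∑' m : ℕ, (Metric.ball y (2 ^ m * ρ)).indicator
        (fun _ ↦ ENNReal.ofReal ((2 ^ m * ρ / 2) ^ (d + 1))⁻¹) z := fun z ↦ by
    have hex : ∃ m : ℕ, dist z y < 2 ^ m * ρ := by
      obtain ⟨m, hm⟩ := pow_unbounded_of_one_lt (dist z y / ρ) (one_lt_two : (1 : ℝ) < 2)
      exact ⟨m, by rwa [div_lt_iff₀ hρ] at hm⟩
    classical
    refine le_trans ?_ (ENNReal.le_tsum (Nat.find hex))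
    rw [Set.indicator_of_mem (Metric.mem_ball.2 (Nat.find_spec hex))]
    refine ENNReal.ofReal_le_ofReal ?_
    gcongr
    rcases Nat.eq_zero_or_pos (Nat.find hex) with h | h
    · rw [h, pow_zero, one_mul]
      linarith [dist_nonneg (x := z) (y := y)]
    · have h1 := Nat.find_min hex (Nat.sub_lt h one_pos)
      have h2 : (2 : ℝ) ^ Nat.find hex = 2 ^ (Nat.find hex - 1) * 2 := by
        rw [← pow_succ, Nat.sub_add_cancel h]
      rw [h2]
      linarith
  refine (lintegral_mono hpt).trans ?_
  rw [lintegral_tsum fun m ↦ (measurable_const.indicator Metric.isOpen_ball.measurableSet).aemeasurable]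
  have hterm : ∀ m : ℕ, ∫⁻ z, (Metric.ball y (2 ^ m * ρ)).indicator
      (fun _ ↦ ENNReal.ofReal ((2 ^ m * ρ / 2) ^ (d + 1))⁻¹) z ∂τ ≤
        ENNReal.ofReal (2 ^ (d + 1) * C / ρ * (1 / 2) ^ m) := fun m ↦ by
    rw [lintegral_indicator_const Metric.isOpen_ball.measurableSet]
    refine (mul_le_mul_right (hτ _ (by positivity)) _).trans ?_
    rw [← ENNReal.ofReal_mul (by positivity)]
    refine ENNReal.ofReal_le_ofReal (le_of_eq ?_)
    rw [div_pow, mul_pow, mul_pow, one_div, inv_pow]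
    field_simp
    ring
  refine (ENNReal.tsum_le_tsum hterm).trans ?_
  rw [← ENNReal.ofReal_tsum_of_nonneg (fun m ↦ by positivity)
    (summable_geometric_two.mul_left _), tsum_mul_left, tsum_geometric_two]
  refine ENNReal.ofReal_le_ofReal (le_of_eq ?_)
  rw [pow_succ (2 : ℝ) (d + 1)]
  ring

theorem SchwartzMap.exists_decay {E : Type*} [NormedAddCommGroup E] [NormedSpace ℝ E]
    (η : 𝓢(E, ℂ)) (N : ℕ) : ∃ C : ℝ, 0 ≤ C ∧ (∀ t, ‖η t‖ ≤ C * ((1 + ‖t‖) ^ N)⁻¹) ∧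
      ∀ a b, ‖a - b‖ ≤ 1 → ‖η a - η b‖ ≤ C * ‖a - b‖ * ((1 + ‖b‖) ^ N)⁻¹ := by
  have h : ∀ l, ∃ C : ℝ, 0 ≤ C ∧ ∀ t, ‖iteratedFDeriv ℝ l η t‖ ≤ C * ((1 + ‖t‖) ^ N)⁻¹ := fun l ↦ by
    refine ⟨2 ^ N * (Finset.Iic (N, l)).sup (fun m ↦ SchwartzMap.seminorm ℝ m.1 m.2) η,
      by positivity, fun t ↦ ?_⟩
    rw [← div_eq_mul_inv, le_div_iff₀ (by positivity), mul_comm]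
    exact SchwartzMap.one_add_le_sup_seminorm_apply (𝕜 := ℝ) (m := (N, l)) le_rfl le_rfl η t
  obtain ⟨C₀, hC₀, h₀⟩ := h 0
  obtain ⟨C₁, hC₁, h₁⟩ := h 1
  refine ⟨max C₀ (C₁ * 2 ^ N), le_max_of_le_left hC₀, fun t ↦ ?_, fun a b hab ↦ ?_⟩
  · have := h₀ t
    rw [norm_iteratedFDeriv_zero] at this
    exact this.trans (by gcongr; exact le_max_left _ _)
  · have hd : ∀ t ∈ Metric.closedBall b 1, ‖fderiv ℝ η t‖ ≤ C₁ * 2 ^ N * ((1 + ‖b‖) ^ N)⁻¹ := by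
      intro t ht
      have h2 := h₁ t
      rw [norm_iteratedFDeriv_one] at h2
      -- Within distance 1 of b the weight changes by a factor at most 2, hence the constant 2^N.
      have h3 : 1 + ‖b‖ ≤ 2 * (1 + ‖t‖) := by
        have : ‖b‖ ≤ ‖t‖ + 1 := by
          rw [Metric.mem_closedBall, dist_comm, dist_eq_norm] at ht
          linarith [norm_le_norm_add_norm_sub' b t]
        linarith [norm_nonneg t]
      refine h2.trans ?_
      rw [mul_assoc]
      gcongr
      rw [← div_eq_mul_inv, inv_le_comm₀ (by positivity) (by positivity), inv_div,
        div_le_iff₀ (by positivity), mul_comm, ← mul_pow]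
      gcongr
    have h4 := (convex_closedBall b (1 : ℝ)).norm_image_sub_le_of_norm_fderiv_le
      (fun t _ ↦ η.differentiableAt) hd (Metric.mem_closedBall_self zero_le_one)
      (show a ∈ Metric.closedBall b 1 by rwa [Metric.mem_closedBall, dist_eq_norm])
    refine h4.trans ?_
    rw [mul_right_comm]
    gcongr
    exact le_max_right _ _

section WeightedNorm

variable {n : ℕ}

/-- The weighted average `∫ (ρ + |z - y|) ^ (-n) |g z| ^ p dz`. -/
noncomputable def weightedPow (p ρ : ℝ) (g : EuclideanSpace ℝ (Fin n) → ℂ)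
    (y : EuclideanSpace ℝ (Fin n)) : ℝ≥0∞ :=
  ∫⁻ z, ENNReal.ofReal ((ρ + dist z y) ^ n)⁻¹ * ‖g z‖ₑ ^ p

theorem exists_volume_ball_le (n : ℕ) : ∃ C : ℝ, 0 ≤ C ∧
    ∀ (y : EuclideanSpace ℝ (Fin n)) (r : ℝ), 0 < r →
      volume (Metric.ball y r) = ENNReal.ofReal (C * r ^ n) := by
  refine ⟨(volume (Metric.ball (0 : EuclideanSpace ℝ (Fin n)) 1)).toReal, ENNReal.toReal_nonneg,
    fun y r hr ↦ ?_⟩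
  rw [Measure.addHaar_ball_of_pos _ _ hr, finrank_euclideanSpace_fin, mul_comm,
    ENNReal.ofReal_mul ENNReal.toReal_nonneg, ENNReal.ofReal_toReal measure_ball_lt_top.ne]

/-- The majorant Φ = ρ (ρ + |z - y|)^{-n-1} has integral bounded independently of ρ, and it lies
below the weight (ρ + |z - y|)^{-n}. Hölder with respect to the measure Φ dz gives the estimate. -/
theorem exists_enorm_integral_le_weightedPow (n : ℕ) {p : ℝ} (hp : 1 < p) :
    ∃ c : ℝ≥0, ∀ (ρ A : ℝ) (y : EuclideanSpace ℝ (Fin n)) (κ g : EuclideanSpace ℝ (Fin n) → ℂ),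
      0 < ρ → 0 ≤ A → AEMeasurable g →
      (∀ z, ‖κ z‖ ≤ A * (ρ * ((ρ + dist z y) ^ (n + 1))⁻¹)) →
        ‖∫ z, κ z * g z‖ₑ ≤ c * ENNReal.ofReal A * weightedPow p ρ g y ^ (1 / p) := by
  have hp0 : 0 < p := one_pos.trans hp
  have hpq : p.HolderConjugate (p / (p - 1)) := Real.HolderConjugate.conjExponent hp
  set q := p / (p - 1)
  obtain ⟨C, hC, hvol⟩ := exists_volume_ball_le n
  refine ⟨(2 ^ (n + 2) * C).toNNReal ^ (1 / q), fun ρ A y κ g hρ hA hg hκ ↦ ?_⟩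
  set Φ : EuclideanSpace ℝ (Fin n) → ℝ≥0∞ :=
    fun z ↦ ENNReal.ofReal (ρ * ((ρ + dist z y) ^ (n + 1))⁻¹)
  have hΦm : Measurable Φ := by
    refine ENNReal.measurable_ofReal.comp (Continuous.measurable ?_)
    refine continuous_const.mul (Continuous.inv₀ (by fun_prop) fun z ↦ ?_)
    positivity
  have hΦ : ∫⁻ z, Φ z ≤ ENNReal.ofReal (2 ^ (n + 2) * C) := by
    have h1 := lintegral_inv_add_dist_pow_le hC (fun r hr ↦ (hvol y r hr).le) hρ
    simp only [Φ, ENNReal.ofReal_mul hρ.le]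
    rw [lintegral_const_mul' _ _ ENNReal.ofReal_ne_top]
    refine (mul_le_mul_right h1 _).trans ?_
    rw [← ENNReal.ofReal_mul hρ.le, mul_div_cancel₀ _ hρ.ne']
  have hΦW : ∀ z, Φ z ≤ ENNReal.ofReal ((ρ + dist z y) ^ n)⁻¹ := fun z ↦ by
    refine ENNReal.ofReal_le_ofReal ?_
    have : 0 < ρ + dist z y := by positivity
    rw [pow_succ, mul_inv, mul_comm, mul_assoc]
    refine mul_le_of_le_one_right (by positivity) ?_
    rw [inv_mul_le_iff₀ this]
    linarith [dist_nonneg (x := z) (y := y)]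
  have hsplit : ∀ z, Φ z * ‖g z‖ₑ = Φ z ^ (1 / q) * (Φ z ^ (1 / p) * ‖g z‖ₑ) := fun z ↦ by
    rw [← mul_assoc, ← ENNReal.rpow_add_of_nonneg _ _ hpq.symm.one_div_nonneg hpq.one_div_nonneg,
      one_div, one_div, hpq.symm.inv_add_inv_eq_one, ENNReal.rpow_one]
  calc ‖∫ z, κ z * g z‖ₑ ≤ ∫⁻ z, ‖κ z * g z‖ₑ := enorm_integral_le_lintegral_enorm _
    _ ≤ ∫⁻ z, ENNReal.ofReal A * (Φ z * ‖g z‖ₑ) := by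
        refine lintegral_mono fun z ↦ ?_
        rw [enorm_mul, ← mul_assoc, ← ENNReal.ofReal_mul hA]
        gcongr
        rw [← ofReal_norm]
        exact ENNReal.ofReal_le_ofReal (hκ z)
    _ = ENNReal.ofReal A * ∫⁻ z, Φ z * ‖g z‖ₑ := lintegral_const_mul' _ _ ENNReal.ofReal_ne_top
    _ ≤ ENNReal.ofReal A * ((∫⁻ z, Φ z) ^ (1 / q) *
          (∫⁻ z, Φ z * ‖g z‖ₑ ^ p) ^ (1 / p)) := by
        gcongr
        simp_rw [hsplit]
        refine (ENNReal.lintegral_mul_le_Lp_mul_Lq volume hpq.symm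
          (hΦm.pow_const _).aemeasurable ((hΦm.pow_const _).aemeasurable.mul hg.enorm)).trans ?_
        refine mul_le_mul' (le_of_eq ?_) (le_of_eq ?_)
        · simp_rw [← ENNReal.rpow_mul, one_div_mul_cancel hpq.symm.ne_zero, ENNReal.rpow_one]
        · simp_rw [Pi.mul_apply, ENNReal.mul_rpow_of_nonneg _ _ hp0.le, ← ENNReal.rpow_mul,
            one_div_mul_cancel hp0.ne', ENNReal.rpow_one]
    _ ≤ ENNReal.ofReal A * (ENNReal.ofReal (2 ^ (n + 2) * C) ^ (1 / q) *
          weightedPow p ρ g y ^ (1 / p)) := by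
        unfold weightedPow
        gcongr with z
        exact hΦW z
    _ = _ := by
        rw [ENNReal.coe_rpow_of_nonneg _ hpq.symm.one_div_nonneg]
        change _ = ENNReal.ofReal _ ^ _ * _ * _
        ring

end WeightedNorm

/-! ### Pointwise control of the pieces by weighted averages. -/

namespace LittlewoodPaley

variable {n : ℕ}

/-- Littlewood-Paley pieces are reproduced by convolution with a Schwartz function at scale
`1 / λ`. -/
theorem exists_reproducing_kernel (P : LittlewoodPaley n) :
    ∃ η : 𝓢(EuclideanSpace ℝ (Fin n), ℂ), ∀ (k : ℕ) (x : EuclideanSpace ℝ (Fin n)),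
      ∃ h : 𝓢(EuclideanSpace ℝ (Fin n), ℂ),
        (∀ z, h z = (((2 : ℝ) ^ k) ^ n : ℝ) • η ((2 : ℝ) ^ k • (z - x))) ∧
        ∀ (u : 𝓢'(EuclideanSpace ℝ (Fin n), ℂ)) (q : ℝ≥0∞), 1 ≤ q → MemLp (P.proj k u) q →
          P.proj k u x = ∫ z, h z * P.proj k u z := by
  obtain ⟨R, hR⟩ := P.exists_radius
  obtain ⟨χ, hχc, hχ⟩ := exists_schwartzMap_eq_one (E := EuclideanSpace ℝ (Fin n)) R
  refine ⟨𝓕 χ, fun k x ↦ ?_⟩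
  have hc : HasCompactSupport fun ξ ↦
      Complex.exp ((2 * Real.pi * inner ℝ x ξ : ℝ) * Complex.I) * χ (((2 : ℝ) ^ k)⁻¹ • ξ) :=
    (hχc.comp_smul (by positivity)).mul_left
  have hs : ContDiff ℝ ∞ fun ξ ↦
      Complex.exp ((2 * Real.pi * inner ℝ x ξ : ℝ) * Complex.I) * χ (((2 : ℝ) ^ k)⁻¹ • ξ) :=
    ((Complex.ofRealCLM.contDiff.comp
      (contDiff_const.mul (contDiff_const.inner ℝ contDiff_id))).mul contDiff_const).cexp.mul
        ((χ.smooth ⊤).comp (contDiff_const_smul _))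
  refine ⟨𝓕 (hc.toSchwartzMap hs), fun z ↦ ?_, fun u q hq hu ↦ ?_⟩
  · rw [SchwartzMap.fourier_coe, SchwartzMap.fourier_coe, Real.fourier_eq', Real.fourier_eq']
    have h1 := Measure.integral_comp_inv_smul_of_nonneg (volume : Measure (EuclideanSpace ℝ (Fin n)))
      (fun ξ ↦ Complex.exp (↑(-2 * Real.pi * inner ℝ ξ ((2 : ℝ) ^ k • (z - x))) * Complex.I) • χ ξ)
      (show (0 : ℝ) ≤ 2 ^ k by positivity)
    rw [finrank_euclideanSpace_fin] at h1
    rw [← h1]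
    refine integral_congr_ae (Eventually.of_forall fun ξ ↦ ?_)
    simp only [HasCompactSupport.toSchwartzMap_toFun, smul_eq_mul]
    rw [← mul_assoc, ← Complex.exp_add, inner_smul_left, inner_smul_right, inner_sub_right,
      real_inner_comm ξ x]
    congr 2
    have : ((2 : ℝ) ^ k)⁻¹ * ((2 : ℝ) ^ k * (inner ℝ ξ z - inner ℝ ξ x)) =
        inner ℝ ξ z - inner ℝ ξ x := by field_simp
    simp only [conj_trivial, this]
    push_cast
    ring
  · have h2 := P.apply_mult_fourierInv k u hq hu (𝓕 (hc.toSchwartzMap hs))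
    rw [FourierTransform.fourierInv_fourier_eq] at h2
    refine Eq.trans ?_ h2
    -- The rescaled χ is 1 on the support of m_λ, so the multiplier restores exactly the test
    -- function that defines P_λ u(x).
    have h3 : SchwartzMap.smulLeftCLM ℂ (P.mult k) (hc.toSchwartzMap hs) = P.waveTest k x := by
      ext ξ
      rw [SchwartzMap.smulLeftCLM_apply_apply
        ((P.mult_compact _).hasTemperateGrowth (P.mult_smooth _)), waveTest_apply]
      simp only [HasCompactSupport.toSchwartzMap_toFun, smul_eq_mul]
      by_cases h0 : P.mult k ξ = 0
      · simp [h0]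
      · rw [hχ _ (hR k ξ h0)]
        ring
    rw [h3]
    rfl

theorem exists_proj_le_weightedPow (P : LittlewoodPaley n) {p : ℝ} (hp : 1 < p) :
    ∃ c : ℝ≥0, ∀ (k : ℕ) (u : 𝓢'(EuclideanSpace ℝ (Fin n), ℂ)),
      MemLp (P.proj k u) (ENNReal.ofReal p) → ∀ y,
        ‖P.proj k u y‖ₑ ≤ c * weightedPow p ((2 : ℝ) ^ k)⁻¹ (P.proj k u) y ^ (1 / p) ∧
        ∀ x, 2 ^ k * dist x y ≤ 1 → ‖P.proj k u x - P.proj k u y‖ₑ ≤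
          c * ENNReal.ofReal (2 ^ k * dist x y) *
            weightedPow p ((2 : ℝ) ^ k)⁻¹ (P.proj k u) y ^ (1 / p) := by
  obtain ⟨η, hη⟩ := P.exists_reproducing_kernel
  obtain ⟨C, hC, hη0, hη1⟩ := η.exists_decay (n + 1)
  obtain ⟨c, hc⟩ := exists_enorm_integral_le_weightedPow n hp
  refine ⟨c * C.toNNReal, fun k u hu y ↦ ?_⟩
  have hq : 1 ≤ ENNReal.ofReal p := by simpa using hp.le
  have hg := (P.continuous_proj k u).measurable.aemeasurable (μ := volume)
  have hint : ∀ h : 𝓢(EuclideanSpace ℝ (Fin n), ℂ), Integrable fun z ↦ h z * P.proj k u z :=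
    fun h ↦ by
      have : (ENNReal.ofReal p).HolderConjugate (ENNReal.ofReal (p / (p - 1))) :=
        (Real.HolderConjugate.conjExponent hp).ennrealOfReal
      have := this.symm
      exact MemLp.integrable_mul (h.memLp (ENNReal.ofReal (p / (p - 1)))) hu
  -- Decay of order n + 1 of the L¹-normalised kernel is the majorant above with ρ = 2^{-k}.
  have hscale : ∀ z, ((2 : ℝ) ^ k) ^ n * ((1 + ‖(2 : ℝ) ^ k • (z - y)‖) ^ (n + 1))⁻¹ =
      ((2 : ℝ) ^ k)⁻¹ * ((((2 : ℝ) ^ k)⁻¹ + dist z y) ^ (n + 1))⁻¹ := fun z ↦ by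
    rw [norm_smul, norm_pow, Real.norm_ofNat, ← dist_eq_norm]
    have h1 : 1 + (2 : ℝ) ^ k * dist z y = 2 ^ k * (((2 : ℝ) ^ k)⁻¹ + dist z y) := by
      field_simp
    have : 0 < ((2 : ℝ) ^ k)⁻¹ + dist z y := by positivity
    rw [h1, mul_pow, mul_inv, pow_succ ((2 : ℝ) ^ k) n]
    field_simp
  have h2 : ∀ A : ℝ, 0 ≤ A → (c : ℝ≥0∞) * ENNReal.ofReal (C * A) =
      ((c * C.toNNReal : ℝ≥0) : ℝ≥0∞) * ENNReal.ofReal A := fun A hA ↦ by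
    rw [ENNReal.ofReal_mul hC, ENNReal.coe_mul, mul_assoc]
    rfl
  obtain ⟨h, hh, hrep⟩ := hη k y
  refine ⟨?_, fun x hx ↦ ?_⟩
  · have h1 := hc ((2 : ℝ) ^ k)⁻¹ (C * 1) y h (P.proj k u) (by positivity) (by positivity) hg
      fun z ↦ by
        rw [hh, norm_smul, Real.norm_of_nonneg (by positivity), mul_one, ← hscale]
        calc _ ≤ ((2 : ℝ) ^ k) ^ n * (C * ((1 + ‖(2 : ℝ) ^ k • (z - y)‖) ^ (n + 1))⁻¹) := by
              gcongr
              exact hη0 _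
          _ = _ := by ring
    rwa [h2 _ zero_le_one, ENNReal.ofReal_one, mul_one, ← hrep u _ hq hu] at h1
  · obtain ⟨h', hh', hrep'⟩ := hη k x
    have h1 := hc ((2 : ℝ) ^ k)⁻¹ (C * (2 ^ k * dist x y)) y (fun z ↦ h' z - h z) (P.proj k u)
      (by positivity) (by positivity) hg fun z ↦ by
        rw [hh, hh', ← smul_sub, norm_smul, Real.norm_of_nonneg (by positivity), mul_assoc,
          ← hscale]
        have h3 : ‖(2 : ℝ) ^ k • (z - x) - (2 : ℝ) ^ k • (z - y)‖ = 2 ^ k * dist x y := by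
          rw [← smul_sub, norm_smul, norm_pow, Real.norm_ofNat, sub_sub_sub_cancel_left,
            dist_comm, dist_eq_norm]
        have h4 := hη1 ((2 : ℝ) ^ k • (z - x)) ((2 : ℝ) ^ k • (z - y)) (by rwa [h3])
        rw [h3] at h4
        calc _ ≤ ((2 : ℝ) ^ k) ^ n * (C * (2 ^ k * dist x y) *
              ((1 + ‖(2 : ℝ) ^ k • (z - y)‖) ^ (n + 1))⁻¹) := by
              gcongr
          _ = _ := by ring
    rw [h2 _ (by positivity)] at h1
    simp_rw [sub_mul] at h1
    rwa [integral_sub (hint h') (hint h), ← hrep u _ hq hu, ← hrep' u _ hq hu] at h1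

end LittlewoodPaley

/-! ### Lipschitz boundaries: surface measure and interior volume. -/

section Geometry

theorem norm_sub_inner_smul_le {E : Type*} [NormedAddCommGroup E] [InnerProductSpace ℝ E] {ν : E}
    (hν : ‖ν‖ = 1) (w : E) : ‖w - inner ℝ ν w • ν‖ ≤ 2 * ‖w‖ := by
  have h1 : |inner ℝ ν w| ≤ ‖w‖ := by simpa [hν] using abs_real_inner_le_norm ν w
  calc ‖w - inner ℝ ν w • ν‖ ≤ ‖w‖ + ‖inner ℝ ν w • ν‖ := norm_sub_le _ _
    _ ≤ 2 * ‖w‖ := by rw [norm_smul, hν, mul_one, Real.norm_eq_abs]; linarith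

/-- The Hausdorff measure of the part of a Lipschitz graph in a ball of radius `r` is
`O(r ^ m)`. -/
theorem exists_hausdorffMeasure_graph_inter_ball_le {m : ℕ} {ν : EuclideanSpace ℝ (Fin (m + 1))}
    (hν : ‖ν‖ = 1) {L : ℝ≥0} {ψ : EuclideanSpace ℝ (Fin (m + 1)) → ℝ} (hψ : LipschitzWith L ψ) :
    ∃ C : ℝ, 0 ≤ C ∧ ∀ z r, 0 < r → Measure.hausdorffMeasure (m : ℝ)
      ({x | inner ℝ ν x = ψ (x - inner ℝ ν x • ν)} ∩ Metric.ball z r) ≤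
        ENNReal.ofReal (C * r ^ m) := by
  -- The graph is the Lipschitz image of ν^⊥, parametrised by `Fin m → ℝ` with the sup norm: there
  -- Hausdorff measure is Lebesgue measure and balls are cubes.
  have hfr : Module.finrank ℝ (Fin m → ℝ) = Module.finrank ℝ (ℝ ∙ ν)ᗮ := by
    have : Fact (Module.finrank ℝ (EuclideanSpace ℝ (Fin (m + 1))) = m + 1) :=
      ⟨finrank_euclideanSpace_fin⟩
    rw [Submodule.finrank_orthogonal_span_singleton (n := m)
      (by rintro rfl; simp at hν), Module.finrank_fin_fun]
  let ℓ : (Fin m → ℝ) ≃L[ℝ] (ℝ ∙ ν)ᗮ := ContinuousLinearEquiv.ofFinrankEq hfr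
  have hmem : ∀ x, x - inner ℝ ν x • ν ∈ (ℝ ∙ ν)ᗮ := fun x ↦ by
    rw [Submodule.mem_orthogonal_singleton_iff_inner_right, inner_sub_right, inner_smul_right,
      real_inner_self_eq_norm_sq, hν]
    ring
  let ℓ' : (Fin m → ℝ) →L[ℝ] EuclideanSpace ℝ (Fin (m + 1)) :=
    (ℝ ∙ ν)ᗮ.subtypeL ∘L (ℓ : (Fin m → ℝ) →L[ℝ] (ℝ ∙ ν)ᗮ)
  let Γ : (Fin m → ℝ) → EuclideanSpace ℝ (Fin (m + 1)) := fun t ↦ ℓ' t + ψ (ℓ' t) • ν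
  have hΓ : LipschitzWith (‖ℓ'‖₊ + L * ‖ℓ'‖₊) Γ := by
    refine ℓ'.lipschitz.add (LipschitzWith.of_dist_le_mul fun t t' ↦ ?_)
    rw [dist_eq_norm, ← sub_smul, norm_smul, hν, mul_one, ← dist_eq_norm]
    exact (hψ.comp ℓ'.lipschitz).dist_le_mul t t'
  set K := ‖ℓ'‖₊ + L * ‖ℓ'‖₊
  set M : ℝ := ‖(ℓ.symm : (ℝ ∙ ν)ᗮ →L[ℝ] Fin m → ℝ)‖
  refine ⟨K ^ m * (2 * (M * 2)) ^ m, by positivity, fun z r hr ↦ ?_⟩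
  have hsub : {x | inner ℝ ν x = ψ (x - inner ℝ ν x • ν)} ∩ Metric.ball z r ⊆
      Γ '' Metric.closedBall (ℓ.symm ⟨_, hmem z⟩) (M * (2 * r)) := by
    rintro x ⟨hx, hxz⟩
    refine ⟨ℓ.symm ⟨_, hmem x⟩, ?_, ?_⟩
    · rw [Metric.mem_closedBall, dist_eq_norm, ← map_sub]
      refine ((ℓ.symm : (ℝ ∙ ν)ᗮ →L[ℝ] Fin m → ℝ).le_opNorm _).trans ?_
      gcongr
      rw [Submodule.coe_norm]
      have h1 : (x - inner ℝ ν x • ν) - (z - inner ℝ ν z • ν) =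
          (x - z) - inner ℝ ν (x - z) • ν := by
        rw [inner_sub_right, sub_smul]
        abel
      simp only [AddSubgroupClass.coe_sub, h1]
      refine (norm_sub_inner_smul_le hν _).trans ?_
      rw [← dist_eq_norm]
      gcongr
      exact (Metric.mem_ball.1 hxz).le
    · have h2 : ℓ' (ℓ.symm ⟨_, hmem x⟩) = x - inner ℝ ν x • ν := by simp [ℓ']
      simp only [Γ, h2]
      rw [← show inner ℝ ν x = ψ (x - inner ℝ ν x • ν) from hx]
      abel
  calc _ ≤ Measure.hausdorffMeasure (m : ℝ)
        (Γ '' Metric.closedBall (ℓ.symm ⟨_, hmem z⟩) (M * (2 * r))) := measure_mono hsub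
    _ ≤ (K : ℝ≥0∞) ^ (m : ℝ) * Measure.hausdorffMeasure (m : ℝ)
        (Metric.closedBall (ℓ.symm ⟨_, hmem z⟩) (M * (2 * r))) :=
      (hΓ.lipschitzOnWith (s := _)).hausdorffMeasure_image_le (Nat.cast_nonneg m)
    _ = ENNReal.ofReal (K ^ m) * ENNReal.ofReal ((2 * (M * (2 * r))) ^ m) := by
      have h3 : (Measure.hausdorffMeasure (m : ℝ) : Measure (Fin m → ℝ)) = volume := by
        have := hausdorffMeasure_pi_real (ι := Fin m)
        rwa [Fintype.card_fin] at this
      rw [h3, Real.volume_pi_closedBall _ (by positivity), Fintype.card_fin, ENNReal.rpow_natCast,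
        ENNReal.ofReal_pow (NNReal.coe_nonneg K) m, ENNReal.ofReal_coe_nnreal]
    _ = _ := by
      rw [← ENNReal.ofReal_mul (by positivity)]
      congr 1
      rw [mul_assoc, ← mul_pow]
      ring

variable {n : ℕ} {Ω : Set (EuclideanSpace ℝ (Fin n))}

/-- A frontier point is not in the open set Ω, so it is not above the graph; strictly below it, a
neighbourhood would miss Ω. -/
theorem frontier_inter_ball_subset_graph (hΩ : IsOpen Ω) {y ν : EuclideanSpace ℝ (Fin n)} {δ : ℝ}
    {ψ : EuclideanSpace ℝ (Fin n) → ℝ} (hψ : Continuous ψ)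
    (h : ∀ x ∈ Metric.ball y δ, x ∈ Ω ↔ ψ (x - inner ℝ ν x • ν) < inner ℝ ν x) :
    frontier Ω ∩ Metric.ball y δ ⊆ {x | inner ℝ ν x = ψ (x - inner ℝ ν x • ν)} := by
  rintro x ⟨hxf, hxb⟩
  have hxΩ : x ∉ Ω := by
    rw [hΩ.frontier_eq] at hxf
    exact hxf.2
  have h1 : inner ℝ ν x ≤ ψ (x - inner ℝ ν x • ν) := by
    by_contra hc
    exact hxΩ ((h x hxb).2 (not_le.1 hc))
  refine h1.antisymm ?_
  by_contra hc
  have hopen : IsOpen {z | inner ℝ ν z < ψ (z - inner ℝ ν z • ν)} :=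
    isOpen_lt (by fun_prop) (by fun_prop)
  obtain ⟨z, ⟨hz1, hz2⟩, hzΩ⟩ := mem_closure_iff.1 (frontier_subset_closure hxf) _
    (hopen.inter Metric.isOpen_ball) ⟨not_le.1 hc, hxb⟩
  have h2 : inner ℝ ν z < ψ (z - inner ℝ ν z • ν) := hz1
  exact absurd ((h z hz2).1 hzΩ) (not_lt.2 h2.le)

/-- Interior cone condition: a ball of radius proportional to r around y + (r/2)ν lies in Ω. -/
theorem IsLipschitzDomain.exists_volume_ball_inter_ge (hΩ : IsLipschitzDomain Ω)
    {y : EuclideanSpace ℝ (Fin n)} (hy : y ∈ frontier Ω) :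
    ∃ δ c : ℝ, 0 < δ ∧ 0 < c ∧ ∀ r, 0 < r → r ≤ δ →
      ENNReal.ofReal (c * r ^ n) ≤ volume (Metric.ball y r ∩ Ω) := by
  obtain ⟨δ, ν, L, ψ, hδ, hν, hψ, h⟩ := hΩ.graph y hy
  obtain ⟨C, hC, hvol⟩ := exists_volume_ball_le n
  have hC0 : 0 < C := by
    refine hC.lt_of_ne fun h0 ↦ ?_
    have h1 := hvol y 1 one_pos
    rw [← h0, zero_mul, ENNReal.ofReal_zero] at h1
    exact (Metric.measure_ball_pos volume y one_pos).ne' h1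
  -- A displacement w lowers the height by at most |w| and raises ψ by at most 2L|w|. This ε keeps
  -- the total below r/4, less than the available r/2.
  set ε : ℝ := (4 * (1 + 2 * L))⁻¹ with hε
  have hε0 : 0 < ε := by positivity
  have hε1 : (1 + 2 * L) * ε = 1 / 4 := by rw [hε]; field_simp
  have hε2 : ε ≤ 1 / 4 := by nlinarith [L.2, mul_nonneg L.2 hε0.le]
  refine ⟨δ, C * ε ^ n, hδ, by positivity, fun r hr hrδ ↦ ?_⟩
  have hgr : inner ℝ ν y = ψ (y - inner ℝ ν y • ν) :=
    frontier_inter_ball_subset_graph hΩ.isOpen hψ.continuous h ⟨hy, Metric.mem_ball_self hδ⟩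
  have h1 := hvol (y + (r / 2) • ν) (ε * r) (by positivity)
  rw [mul_pow, ← mul_assoc] at h1
  rw [← h1]
  refine measure_mono fun x hx ↦ ?_
  set w := x - (y + (r / 2) • ν) with hw
  have hwn : ‖w‖ < ε * r := by rwa [Metric.mem_ball, dist_eq_norm] at hx
  have hxw : x = y + (r / 2) • ν + w := by rw [hw]; abel
  have hxr : x ∈ Metric.ball y r := by
    rw [Metric.mem_ball, dist_eq_norm, hxw, add_assoc, add_sub_cancel_left]
    refine (norm_add_le _ _).trans_lt ?_
    rw [norm_smul, hν, mul_one, Real.norm_of_nonneg (by positivity)]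
    nlinarith
  refine ⟨hxr, (h x (Metric.ball_subset_ball hrδ hxr)).2 ?_⟩
  have hin : inner ℝ ν x = inner ℝ ν y + r / 2 + inner ℝ ν w := by
    rw [hxw, inner_add_right, inner_add_right, inner_smul_right, real_inner_self_eq_norm_sq, hν]
    ring
  have hiw : |inner ℝ ν w| ≤ ‖w‖ := by simpa [hν] using abs_real_inner_le_norm ν w
  have hd : (x - inner ℝ ν x • ν) - (y - inner ℝ ν y • ν) = w - inner ℝ ν w • ν := by
    rw [hin, hxw, add_smul, add_smul]
    abel
  have hL := hψ.dist_le_mul (x - inner ℝ ν x • ν) (y - inner ℝ ν y • ν)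
  rw [dist_eq_norm, dist_eq_norm, hd, Real.norm_eq_abs] at hL
  have hL2 := mul_le_mul_of_nonneg_left (norm_sub_inner_smul_le hν w) L.2
  have := (abs_le.1 hL).2
  have := (abs_le.1 hiw).1
  have hLw : (L : ℝ) * ‖w‖ ≤ L * (ε * r) := mul_le_mul_of_nonneg_left hwn.le L.2
  change (L : ℝ) * ‖w - inner ℝ ν w • ν‖ ≤ L * (2 * ‖w‖) at hL2
  have : (1 + 2 * L) * ε * r = 1 / 4 * r := by rw [hε1]
  have : (1 + 2 * L) * ε * r = ε * r + 2 * (L * (ε * r)) := by ring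
  linarith

/-- The centre z is arbitrary, not only on the boundary: after Tonelli the balls are centred at the
integration variable of |P_k u|^p. -/
theorem IsLipschitzDomain.exists_boundaryMeasure_ball_le {m : ℕ}
    {Ω : Set (EuclideanSpace ℝ (Fin (m + 1)))} (hΩ : IsLipschitzDomain Ω)
    {y : EuclideanSpace ℝ (Fin (m + 1))} (hy : y ∈ frontier Ω) :
    ∃ δ C : ℝ, 0 < δ ∧ 0 ≤ C ∧ ∀ z r, 0 < r →
      (boundaryMeasure Ω).restrict (Metric.ball y δ) (Metric.ball z r) ≤
        ENNReal.ofReal (C * r ^ m) := by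
  obtain ⟨δ, ν, L, ψ, hδ, hν, hψ, h⟩ := hΩ.graph y hy
  obtain ⟨C, hC, hG⟩ := exists_hausdorffMeasure_graph_inter_ball_le hν hψ
  refine ⟨δ, C, hδ, hC, fun z r hr ↦ (le_trans ?_ (hG z r hr))⟩
  have hm : ((m + 1 : ℕ) : ℝ) - 1 = m := by push_cast; ring
  rw [boundaryMeasure, hm, Measure.restrict_apply Metric.isOpen_ball.measurableSet,
    Measure.restrict_apply (Metric.isOpen_ball.inter Metric.isOpen_ball).measurableSet]
  refine measure_mono fun x hx ↦ ⟨?_, hx.1.1⟩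
  exact frontier_inter_ball_subset_graph hΩ.isOpen hψ.continuous h ⟨hx.2, hx.1.2⟩

end Geometry

theorem ENNReal.tsum_ofReal_rpow_pow_lt_top {t : ℝ} (ht : t < 0) :
    ∑' k : ℕ, ENNReal.ofReal (((2 : ℝ) ^ k) ^ t) < ⊤ := by
  have h : ∀ k : ℕ, ENNReal.ofReal (((2 : ℝ) ^ k) ^ t) = ENNReal.ofReal ((2 : ℝ) ^ t) ^ k := fun k ↦ by
    rw [← ENNReal.ofReal_pow (by positivity), ← Real.rpow_natCast, ← Real.rpow_natCast,
      ← Real.rpow_mul zero_le_two, ← Real.rpow_mul zero_le_two, mul_comm]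
  simp_rw [h]
  rw [ENNReal.tsum_geometric, ENNReal.inv_lt_top, tsub_pos_iff_lt, ENNReal.ofReal_lt_one]
  exact Real.rpow_lt_one_of_one_lt_of_neg _root_.one_lt_two ht

/-- From `λ ^ (t p) a ^ p ≤ S` to `a ≤ S ^ (1 / p) λ ^ (-t)`. -/
theorem ENNReal.rpow_le_of_ofReal_mul_le {x t p : ℝ} (hx : 0 < x) (hp : 0 < p) {W S : ℝ≥0∞}
    (h : ENNReal.ofReal (x ^ (t * p)) * W ≤ S) :
    W ^ (1 / p) ≤ S ^ (1 / p) * ENNReal.ofReal (x ^ (-t)) := by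
  have h1 : W ≤ S * ENNReal.ofReal (x ^ (-(t * p))) := by
    have h2 : W = ENNReal.ofReal (x ^ (t * p)) * W * ENNReal.ofReal (x ^ (-(t * p))) := by
      rw [mul_right_comm, ← ENNReal.ofReal_mul (by positivity), ← Real.rpow_add hx, add_neg_cancel,
        Real.rpow_zero, ENNReal.ofReal_one, one_mul]
    rw [h2]
    gcongr
  refine (ENNReal.rpow_le_rpow h1 (by positivity)).trans (le_of_eq ?_)
  rw [ENNReal.mul_rpow_of_nonneg _ _ (by positivity), ENNReal.ofReal_rpow_of_nonneg (by positivity)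
    (by positivity), ← Real.rpow_mul hx.le]
  congr 3
  field_simp

/-! ### Decay of the pieces at almost every boundary point. -/

section Besov

variable {n : ℕ} {P : LittlewoodPaley n} {s p : ℝ} {u : 𝓢'(EuclideanSpace ℝ (Fin n), ℂ)}

theorem MemBesov.tsum_eLpNorm_lt_top (hu : MemBesov P s p u) (hs : 0 < s) (hp : 0 < p) :
    ∑' k, eLpNorm (P.proj k u) (ENNReal.ofReal p) volume < ⊤ := by
  have h1 : ∀ k : ℕ, eLpNorm (P.proj k u) (ENNReal.ofReal p) volume ≤
      (∑' k : ℕ, ENNReal.ofReal (((2 : ℝ) ^ k) ^ (s * p)) *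
        eLpNorm (P.proj k u) (ENNReal.ofReal p) volume ^ p) ^ (1 / p) *
          ENNReal.ofReal (((2 : ℝ) ^ k) ^ (-s)) := fun k ↦ by
    have := ENNReal.rpow_le_of_ofReal_mul_le (x := (2 : ℝ) ^ k) (by positivity) hp
      (ENNReal.le_tsum (f := fun k : ℕ ↦ ENNReal.ofReal (((2 : ℝ) ^ k) ^ (s * p)) *
        eLpNorm (P.proj k u) (ENNReal.ofReal p) volume ^ p) k)
    rwa [← ENNReal.rpow_mul, mul_one_div_cancel hp.ne', ENNReal.rpow_one] at this
  refine (ENNReal.tsum_le_tsum h1).trans_lt ?_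
  rw [ENNReal.tsum_mul_left]
  exact ENNReal.mul_lt_top (ENNReal.rpow_lt_top_of_nonneg (by positivity) (ne_of_lt hu))
    (ENNReal.tsum_ofReal_rpow_pow_lt_top (by linarith))

theorem MemBesov.memLp_proj (hu : MemBesov P s p u) (hs : 0 < s) (hp : 0 < p) (k : ℕ) :
    MemLp (P.proj k u) (ENNReal.ofReal p) :=
  ⟨(P.continuous_proj k u).aestronglyMeasurable,
    (ENNReal.le_tsum k).trans_lt (hu.tsum_eLpNorm_lt_top hs hp)⟩

theorem measurable_weight_mul {ρ : ℝ} (hρ : 0 < ρ) {g : EuclideanSpace ℝ (Fin n) → ℂ}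
    (hg : Continuous g) (p : ℝ) :
    Measurable (Function.uncurry fun y z : EuclideanSpace ℝ (Fin n) ↦
      ENNReal.ofReal ((ρ + dist z y) ^ n)⁻¹ * ‖g z‖ₑ ^ p) := by
  refine Measurable.mul (ENNReal.measurable_ofReal.comp (Continuous.measurable ?_))
    ((hg.measurable.comp measurable_snd).enorm.pow_const p)
  refine Continuous.inv₀ (by fun_prop) fun z ↦ ?_
  positivity

theorem lintegral_weightedPow_le {m : ℕ} {σ : Measure (EuclideanSpace ℝ (Fin (m + 1)))} [SFinite σ]
    {C : ℝ} (hC : 0 ≤ C)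
    (hσ : ∀ z r, 0 < r → σ (Metric.ball z r) ≤ ENNReal.ofReal (C * r ^ m)) {ρ : ℝ} (hρ : 0 < ρ)
    {g : EuclideanSpace ℝ (Fin (m + 1)) → ℂ} (hg : Continuous g) (p : ℝ) :
    ∫⁻ y, weightedPow p ρ g y ∂σ ≤ ENNReal.ofReal (2 ^ (m + 2) * C / ρ) * ∫⁻ z, ‖g z‖ₑ ^ p := by
  unfold weightedPow
  rw [lintegral_lintegral_swap (measurable_weight_mul hρ hg p).aemeasurable,
    ← lintegral_const_mul _ (hg.measurable.enorm.pow_const p)]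
  refine lintegral_mono fun z ↦ ?_
  have h1 : Measurable fun y ↦ ENNReal.ofReal ((ρ + dist z y) ^ (m + 1))⁻¹ := by
    refine ENNReal.measurable_ofReal.comp (Continuous.measurable ?_)
    refine Continuous.inv₀ (by fun_prop) fun z ↦ ?_
    positivity
  rw [lintegral_mul_const _ h1]
  gcongr
  simp_rw [dist_comm z]
  exact lintegral_inv_add_dist_pow_le hC (hσ z) hρ

/-- On a set of dimension `m = n - 1`, the local averages of the Littlewood-Paley pieces of a Besov
function have the decay of the pieces up to a loss of `1 / p` derivatives. -/
theorem MemBesov.ae_exists_weightedPow_le {m : ℕ} {P : LittlewoodPaley (m + 1)}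
    {u : 𝓢'(EuclideanSpace ℝ (Fin (m + 1)), ℂ)}
    (hu : MemBesov P s p u) (hp : 0 < p) {σ : Measure (EuclideanSpace ℝ (Fin (m + 1)))} [SFinite σ]
    {C : ℝ} (hC : 0 ≤ C)
    (hσ : ∀ z r, 0 < r → σ (Metric.ball z r) ≤ ENNReal.ofReal (C * r ^ m)) :
    ∀ᵐ y ∂σ, ∃ B : ℝ≥0∞, B < ⊤ ∧ ∀ k : ℕ, ENNReal.ofReal (((2 : ℝ) ^ k) ^ ((s - 1 / p) * p)) *
      weightedPow p ((2 : ℝ) ^ k)⁻¹ (P.proj k u) y ≤ B := by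
  have hm : ∀ k : ℕ, Measurable fun y ↦ ENNReal.ofReal (((2 : ℝ) ^ k) ^ ((s - 1 / p) * p)) *
      weightedPow p ((2 : ℝ) ^ k)⁻¹ (P.proj k u) y := fun k ↦
    ((measurable_weight_mul (by positivity) (P.continuous_proj k u) p).lintegral_prod_right').const_mul
      _
  have hint : ∫⁻ y, ∑' k : ℕ, ENNReal.ofReal (((2 : ℝ) ^ k) ^ ((s - 1 / p) * p)) *
      weightedPow p ((2 : ℝ) ^ k)⁻¹ (P.proj k u) y ∂σ < ⊤ := by
    rw [lintegral_tsum fun k ↦ (hm k).aemeasurable]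
    refine lt_of_le_of_lt (b := ENNReal.ofReal (2 ^ (m + 2) * C) *
      ∑' k : ℕ, ENNReal.ofReal (((2 : ℝ) ^ k) ^ (s * p)) *
        eLpNorm (P.proj k u) (ENNReal.ofReal p) volume ^ p) ?_
      (ENNReal.mul_lt_top ENNReal.ofReal_lt_top hu)
    rw [← ENNReal.tsum_mul_left]
    refine ENNReal.tsum_le_tsum fun k ↦ ?_
    rw [lintegral_const_mul' _ _ ENNReal.ofReal_ne_top]
    refine (mul_le_mul_right (lintegral_weightedPow_le hC hσ (by positivity)
      (P.continuous_proj k u) p) _).trans (le_of_eq ?_)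
    have h1 : eLpNorm (P.proj k u) (ENNReal.ofReal p) volume ^ p = ∫⁻ z, ‖P.proj k u z‖ₑ ^ p := by
      rw [eLpNorm_ofReal_eq_lintegral hp, ← ENNReal.rpow_mul, one_div_mul_cancel hp.ne',
        ENNReal.rpow_one]
    rw [h1, ← mul_assoc, ← mul_assoc, ← ENNReal.ofReal_mul (by positivity),
      ← ENNReal.ofReal_mul (by positivity), div_inv_eq_mul, mul_left_comm]
    congr 3
    -- The loss 1/ρ = 2^k cancels against (s - 1/p)p = sp - 1.
    rw [sub_mul, one_div_mul_cancel hp.ne', Real.rpow_sub_one (by positivity)]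
    field_simp
  filter_upwards [ae_lt_top' (AEMeasurable.tsum fun k ↦ (hm k).aemeasurable) hint.ne] with y hy
  exact ⟨_, hy, fun k ↦ ENNReal.le_tsum k⟩

/-- Lebesgue measure on the ball of radius `r` around `y`, divided by `r ^ n`. -/
noncomputable def scaledBallMeasure (y : EuclideanSpace ℝ (Fin n)) (r : ℝ) :
    Measure (EuclideanSpace ℝ (Fin n)) :=
  (ENNReal.ofReal (r ^ n))⁻¹ • volume.restrict (Metric.ball y r)

theorem exists_scaledBallMeasure_univ (n : ℕ) : ∃ v : ℝ≥0, ∀ (y : EuclideanSpace ℝ (Fin n)) (r : ℝ),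
    0 < r → scaledBallMeasure y r Set.univ = v := by
  obtain ⟨C, hC, hvol⟩ := exists_volume_ball_le n
  refine ⟨C.toNNReal, fun y r hr ↦ ?_⟩
  rw [scaledBallMeasure, Measure.smul_apply, Measure.restrict_apply_univ, hvol y r hr, smul_eq_mul,
    mul_comm C, ENNReal.ofReal_mul (by positivity), ← mul_assoc,
    ENNReal.inv_mul_cancel (by simpa using by positivity) ENNReal.ofReal_ne_top, one_mul]
  rfl

/-- On the ball ρ + |z - y| ≤ 2r, so the weight is at least (2r)^{-n}. -/
theorem lintegral_scaledBallMeasure_le_weightedPow {ρ r p : ℝ} (hρ : 0 < ρ) (hr : ρ ≤ r)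
    (g : EuclideanSpace ℝ (Fin n) → ℂ) (y : EuclideanSpace ℝ (Fin n)) :
    ∫⁻ z, ‖g z‖ₑ ^ p ∂(scaledBallMeasure y r) ≤ 2 ^ n * weightedPow p ρ g y := by
  have hr0 : 0 < r := hρ.trans_le hr
  rw [scaledBallMeasure, lintegral_smul_measure, weightedPow, smul_eq_mul,
    ← lintegral_const_mul' _ _ (by simpa using by positivity),
    ← lintegral_const_mul' _ _ (by simp)]
  refine (setLIntegral_mono_ae' Metric.isOpen_ball.measurableSet (Eventually.of_forall fun z hz ↦ ?_)).trans
    (setLIntegral_le_lintegral (Metric.ball y r) _)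
  rw [← mul_assoc]
  gcongr
  have h2 : (2 : ℝ≥0∞) ^ n = ENNReal.ofReal (2 ^ n) := by
    rw [ENNReal.ofReal_pow zero_le_two, ENNReal.ofReal_ofNat]
  rw [h2, ← ENNReal.ofReal_mul (by positivity), ← ENNReal.ofReal_inv_of_pos (by positivity)]
  refine ENNReal.ofReal_le_ofReal ?_
  rw [← div_eq_mul_inv, ← div_pow, ← inv_pow]
  have h3 : ρ + dist z y ≤ 2 * r := by linarith [Metric.mem_ball.1 hz]
  have h4 : 0 < ρ + dist z y := by positivity
  gcongr
  rw [inv_eq_one_div, div_le_div_iff₀ hr0 h4]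
  linarith

theorem LittlewoodPaley.summable_proj_of_weightedPow_le (hp : 1 < p) (hs : 1 / p < s)
    (hg : ∀ k, MemLp (P.proj k u) (ENNReal.ofReal p)) {y : EuclideanSpace ℝ (Fin n)} {B : ℝ≥0∞}
    (hB : B < ⊤) (hW : ∀ k : ℕ, ENNReal.ofReal (((2 : ℝ) ^ k) ^ ((s - 1 / p) * p)) *
      weightedPow p ((2 : ℝ) ^ k)⁻¹ (P.proj k u) y ≤ B) : Summable fun k ↦ P.proj k u y := by
  have hp0 : 0 < p := one_pos.trans hp
  obtain ⟨c, hc⟩ := P.exists_proj_le_weightedPow hp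
  refine Summable.of_enorm (ne_of_lt ?_)
  have h1 : ∀ k : ℕ, ‖P.proj k u y‖ₑ ≤
      c * B ^ (1 / p) * ENNReal.ofReal (((2 : ℝ) ^ k) ^ (-(s - 1 / p))) := fun k ↦ by
    refine (hc k u (hg k) y).1.trans ?_
    rw [mul_assoc]
    gcongr
    exact ENNReal.rpow_le_of_ofReal_mul_le (by positivity) hp0 (hW k)
  refine (ENNReal.tsum_le_tsum h1).trans_lt ?_
  rw [ENNReal.tsum_mul_left]
  exact ENNReal.mul_lt_top (ENNReal.mul_lt_top ENNReal.coe_lt_top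
    (ENNReal.rpow_lt_top_of_nonneg (by positivity) hB.ne))
    (ENNReal.tsum_ofReal_rpow_pow_lt_top (by linarith))

/-- Oscillation of the Littlewood-Paley pieces on balls around a point of good decay. -/
theorem LittlewoodPaley.exists_lintegral_tsum_le (hp : 1 < p) (hs' : s < 1 + 1 / p)
    (hg : ∀ k, MemLp (P.proj k u) (ENNReal.ofReal p)) {y : EuclideanSpace ℝ (Fin n)} {B : ℝ≥0∞}
    (hB : B < ⊤) (hW : ∀ k : ℕ, ENNReal.ofReal (((2 : ℝ) ^ k) ^ ((s - 1 / p) * p)) *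
      weightedPow p ((2 : ℝ) ^ k)⁻¹ (P.proj k u) y ≤ B) {α : ℝ} (hα : 0 ≤ α) (hα' : α < s - 1 / p) :
    ∃ C : ℝ≥0, ∀ r : ℝ, 0 < r →
      (∫⁻ x, (∑' k, ‖P.proj k u x - P.proj k u y‖ₑ) ^ p ∂(scaledBallMeasure y r)) ^ (1 / p) ≤
        C * ENNReal.ofReal (r ^ α) := by
  have hp0 : 0 < p := one_pos.trans hp
  obtain ⟨c, hc⟩ := P.exists_proj_le_weightedPow hp
  obtain ⟨v, hv⟩ := exists_scaledBallMeasure_univ n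
  set β := s - 1 / p with hβ
  set Q : ℝ≥0∞ := ((2 ^ n) ^ (1 / p) + c * v ^ (1 / p)) * B ^ (1 / p) with hQ
  have hQ_top : Q < ⊤ := by
    refine ENNReal.mul_lt_top (ENNReal.add_lt_top.2 ⟨?_, ENNReal.mul_lt_top ENNReal.coe_lt_top ?_⟩) ?_
    · exact ENNReal.rpow_lt_top_of_nonneg (by positivity) (by simp)
    · exact ENNReal.rpow_lt_top_of_nonneg (by positivity) (by simp)
    · exact ENNReal.rpow_lt_top_of_nonneg (by positivity) hB.ne
  have hWk : ∀ k : ℕ, weightedPow p ((2 : ℝ) ^ k)⁻¹ (P.proj k u) y ^ (1 / p) ≤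
      B ^ (1 / p) * ENNReal.ofReal (((2 : ℝ) ^ k) ^ (-β)) := fun k ↦
    ENNReal.rpow_le_of_ofReal_mul_le (by positivity) hp0 (hW k)
  have hm : ∀ k, Continuous (P.proj k u) := fun k ↦ P.continuous_proj k u
  have hconst : ∀ (a : ℝ≥0∞) (r : ℝ), 0 < r →
      (∫⁻ _, a ^ p ∂(scaledBallMeasure y r)) ^ (1 / p) = a * v ^ (1 / p) := fun a r hr ↦ by
    rw [lintegral_const, hv y r hr, ENNReal.mul_rpow_of_nonneg _ _ (by positivity),
      ← ENNReal.rpow_mul, mul_one_div_cancel hp0.ne', ENNReal.rpow_one]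
  have hN : ∀ (r : ℝ), 0 < r → ∀ k : ℕ,
      (∫⁻ x, ‖P.proj k u x - P.proj k u y‖ₑ ^ p ∂(scaledBallMeasure y r)) ^ (1 / p) ≤
        Q * ENNReal.ofReal (r ^ α) * ENNReal.ofReal (((2 : ℝ) ^ k) ^ (α - β)) := by
    intro r hr k
    have hkey : Q * ENNReal.ofReal (r ^ α) * ENNReal.ofReal (((2 : ℝ) ^ k) ^ (α - β)) =
        Q * (ENNReal.ofReal ((2 ^ k * r) ^ α) * ENNReal.ofReal (((2 : ℝ) ^ k) ^ (-β))) := by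
      rw [mul_assoc, ← ENNReal.ofReal_mul (by positivity), ← ENNReal.ofReal_mul (by positivity),
        Real.mul_rpow (by positivity) hr.le, sub_eq_add_neg, Real.rpow_add (by positivity)]
      congr 2
      ring
    rw [hkey]
    -- Low frequencies use the Lipschitz bound, high frequencies the triangle inequality; min(2^k r,
    -- 1) ≤ (2^k r)^α unites the two.
    rcases le_or_gt (2 ^ k * r) 1 with h | h
    · have h1 : ∀ᵐ x ∂(scaledBallMeasure y r), ‖P.proj k u x - P.proj k u y‖ₑ ^ p ≤
          (c * ENNReal.ofReal (2 ^ k * r) *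
            weightedPow p ((2 : ℝ) ^ k)⁻¹ (P.proj k u) y ^ (1 / p)) ^ p := by
        refine Measure.ae_smul_measure (ae_restrict_of_forall_mem
          Metric.isOpen_ball.measurableSet fun x hx ↦ ?_) _
        have hxr : (2 : ℝ) ^ k * dist x y ≤ 2 ^ k * r := by
          gcongr
          exact (Metric.mem_ball.1 hx).le
        refine ENNReal.rpow_le_rpow (((hc k u (hg k) y).2 x (hxr.trans h)).trans ?_) hp0.le
        gcongr
      refine (ENNReal.rpow_le_rpow (lintegral_mono_ae h1) (by positivity)).trans ?_
      rw [hconst _ r hr]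
      -- This is where s < 1 + 1/p enters, through α ≤ 1.
      have h2 : (2 : ℝ) ^ k * r ≤ (2 ^ k * r) ^ α := by
        have := Real.rpow_le_rpow_of_exponent_ge (show 0 < (2 : ℝ) ^ k * r by positivity) h
          (show α ≤ 1 by linarith)
        rwa [Real.rpow_one] at this
      calc _ ≤ c * ENNReal.ofReal ((2 ^ k * r) ^ α) * (B ^ (1 / p) *
            ENNReal.ofReal (((2 : ℝ) ^ k) ^ (-β))) * v ^ (1 / p) := by
            gcongr
            exact hWk k
        _ = c * v ^ (1 / p) * B ^ (1 / p) * (ENNReal.ofReal ((2 ^ k * r) ^ α) *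
            ENNReal.ofReal (((2 : ℝ) ^ k) ^ (-β))) := by ring
        _ ≤ _ := by
            rw [hQ]
            gcongr
            exact le_add_self
    · have h1 := eLpNorm_sub_le (p := ENNReal.ofReal p) (μ := scaledBallMeasure y r)
        (f := P.proj k u) (g := fun _ ↦ P.proj k u y) (hm k).aestronglyMeasurable
        aestronglyMeasurable_const (by simpa using hp.le)
      simp only [eLpNorm_ofReal_eq_lintegral hp0, Pi.sub_apply] at h1
      refine h1.trans ?_
      rw [hconst _ r hr]
      have h2 : (1 : ℝ≥0∞) ≤ ENNReal.ofReal ((2 ^ k * r) ^ α) := by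
        rw [ENNReal.one_le_ofReal]
        exact Real.one_le_rpow h.le hα
      have h3 : ((2 : ℝ) ^ k)⁻¹ ≤ r := by
        rw [inv_le_iff_one_le_mul₀ (by positivity), mul_comm]
        exact h.le
      calc _ ≤ (2 ^ n * weightedPow p ((2 : ℝ) ^ k)⁻¹ (P.proj k u) y) ^ (1 / p) +
            c * weightedPow p ((2 : ℝ) ^ k)⁻¹ (P.proj k u) y ^ (1 / p) * v ^ (1 / p) := by
            gcongr
            · exact lintegral_scaledBallMeasure_le_weightedPow (by positivity) h3 _ _
            · exact (hc k u (hg k) y).1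
        _ = ((2 ^ n) ^ (1 / p) + c * v ^ (1 / p)) *
              weightedPow p ((2 : ℝ) ^ k)⁻¹ (P.proj k u) y ^ (1 / p) := by
            rw [ENNReal.mul_rpow_of_nonneg _ _ (by positivity)]
            ring
        _ ≤ ((2 ^ n) ^ (1 / p) + c * v ^ (1 / p)) *
              (B ^ (1 / p) * (1 * ENNReal.ofReal (((2 : ℝ) ^ k) ^ (-β)))) := by
            rw [one_mul]
            gcongr
            exact hWk k
        _ ≤ _ := by
            rw [hQ, mul_assoc]
            gcongr
  have hT : Q * ∑' k : ℕ, ENNReal.ofReal (((2 : ℝ) ^ k) ^ (α - β)) < ⊤ :=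
    ENNReal.mul_lt_top hQ_top (ENNReal.tsum_ofReal_rpow_pow_lt_top (by linarith))
  refine ⟨(Q * ∑' k : ℕ, ENNReal.ofReal (((2 : ℝ) ^ k) ^ (α - β))).toNNReal, fun r hr ↦ ?_⟩
  rw [ENNReal.coe_toNNReal hT.ne]
  refine (lintegral_Lp_tsum_le (fun k ↦ ((hm k).sub continuous_const).measurable.enorm.aemeasurable)
    hp.le).trans ((ENNReal.tsum_le_tsum (hN r hr)).trans (le_of_eq ?_))
  rw [ENNReal.tsum_mul_left]
  ring

end Besov

/-! ### Boundary values and their independence of the extension. -/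

section BoundaryValues

variable {n : ℕ} {P : LittlewoodPaley n} {s p : ℝ} {u : 𝓢'(EuclideanSpace ℝ (Fin n), ℂ)}
  {Ω : Set (EuclideanSpace ℝ (Fin n))} {f : EuclideanSpace ℝ (Fin n) → ℂ}

/-- On Ω the function f is a.e. the sum of the pieces of u, so its deviation from the value of the
series at y is at most the sum of their oscillations. The case q = p then yields q < p by Hölder. -/
theorem exists_normalized_setLIntegral_le (hΩ : IsOpen Ω) (hp : 1 < p) (hs : 1 / p < s)
    (hs' : s < 1 + 1 / p) (hu : MemBesov P s p u) (hf : IsRestriction Ω u f)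
    {y : EuclideanSpace ℝ (Fin n)} {B : ℝ≥0∞} (hB : B < ⊤)
    (hW : ∀ k : ℕ, ENNReal.ofReal (((2 : ℝ) ^ k) ^ ((s - 1 / p) * p)) *
      weightedPow p ((2 : ℝ) ^ k)⁻¹ (P.proj k u) y ≤ B) {α : ℝ} (hα : 0 ≤ α) (hα' : α < s - 1 / p) :
    ∃ C : ℝ, 0 ≤ C ∧ ∀ r : ℝ, 0 < r → ∀ q : ℝ, 1 ≤ q → q ≤ p →
      ((ENNReal.ofReal (r ^ n))⁻¹ *
        ∫⁻ x in Metric.ball y r ∩ Ω, ‖f x - ∑' k, P.proj k u y‖ₑ ^ q) ^ (1 / q)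
          ≤ ENNReal.ofReal (C * r ^ α) := by
  have hp0 : 0 < p := one_pos.trans hp
  have hs0 : 0 < s := (one_div_pos.2 hp0).trans hs
  have hg := hu.memLp_proj hs0 hp0
  have hsum := hu.tsum_eLpNorm_lt_top hs0 hp0
  have hgm := fun k ↦ (hg k).1
  have hU := memLp_tsum hp.le hgm hsum
  have hy := P.summable_proj_of_weightedPow_le hp hs hg hB hW
  obtain ⟨C, hC⟩ := P.exists_lintegral_tsum_le hp hs' hg hB hW hα hα'
  obtain ⟨v, hv⟩ := exists_scaledBallMeasure_univ n
  have hfU := hf.ae_eq hΩ (hU.locallyIntegrable (by simpa using hp.le))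
    (P.apply_eq_integral_tsum_proj hp u hsum)
  refine ⟨C * max (1 : ℝ) v, by positivity, fun r hr q hq hqp ↦ ?_⟩
  have hq0 : 0 < q := one_pos.trans_le hq
  set ν : Measure (EuclideanSpace ℝ (Fin n)) :=
    (ENNReal.ofReal (r ^ n))⁻¹ • volume.restrict (Metric.ball y r ∩ Ω) with hν
  have hνle : ν ≤ scaledBallMeasure y r := by
    refine Measure.le_iff.2 fun t ht ↦ ?_
    rw [hν, scaledBallMeasure, Measure.smul_apply, Measure.smul_apply]
    simp only [smul_eq_mul]
    gcongr
    exact Set.inter_subset_left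
  have hfν : ∀ᵐ x ∂ν, f x = ∑' k, P.proj k u x ∧ ∑' k, ‖P.proj k u x‖ₑ < ⊤ := by
    refine Measure.ae_smul_measure ?_ _
    rw [ae_restrict_iff' (Metric.isOpen_ball.inter hΩ).measurableSet]
    filter_upwards [hfU, ae_tsum_enorm_lt_top hp.le hgm hsum] with x h1 h2 hx
    exact ⟨h1 hx.2, h2⟩
  have hmeas : AEStronglyMeasurable (fun x ↦ f x - ∑' k, P.proj k u y) ν := by
    refine AEStronglyMeasurable.sub ?_ aestronglyMeasurable_const
    have h1 : AEStronglyMeasurable (fun x ↦ ∑' k, P.proj k u x) ν :=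
      (hU.1.mono_measure Measure.restrict_le_self).smul_measure _
    exact h1.congr (by filter_upwards [hfν] with x hx using hx.1.symm)
  have hbound : ∀ᵐ x ∂ν, ‖f x - ∑' k, P.proj k u y‖ₑ ≤
      ∑' k, ‖P.proj k u x - P.proj k u y‖ₑ := by
    filter_upwards [hfν] with x hx
    rw [hx.1, ← (Summable.of_enorm hx.2.ne).tsum_sub hy]
    exact enorm_tsum_le_tsum_enorm
  have h1 : eLpNorm' (fun x ↦ f x - ∑' k, P.proj k u y) p ν ≤ C * ENNReal.ofReal (r ^ α) := by
    refine le_trans ?_ (hC r hr)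
    refine ENNReal.rpow_le_rpow ?_ (by positivity)
    refine (lintegral_mono_ae ?_).trans (lintegral_mono' hνle le_rfl)
    filter_upwards [hbound] with x hx
    exact ENNReal.rpow_le_rpow hx hp0.le
  -- The exponent lies in [0, 1], so the Hölder factor is bounded uniformly in q and C can precede
  -- q.
  have h2 : ν Set.univ ^ (1 / q - 1 / p) ≤ ENNReal.ofReal (max 1 v) := by
    have h3 : 1 / p ≤ 1 / q := one_div_le_one_div_of_le hq0 hqp
    have h4 : 1 / q ≤ 1 := (div_le_one hq0).2 hq
    have h5 : 0 ≤ 1 / p := by positivity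
    have h6 : ν Set.univ ≤ ENNReal.ofReal (max 1 v) := by
      refine (hνle Set.univ).trans ?_
      rw [hv y r hr, ← ENNReal.ofReal_coe_nnreal]
      exact ENNReal.ofReal_le_ofReal (le_max_right _ _)
    refine (ENNReal.rpow_le_rpow h6 (by linarith)).trans ?_
    conv_rhs => rw [← ENNReal.rpow_one (ENNReal.ofReal (max 1 v))]
    exact ENNReal.rpow_le_rpow_of_exponent_le
      (ENNReal.one_le_ofReal.2 (le_max_left _ _)) (by linarith)
  have h3 := (eLpNorm'_le_eLpNorm'_mul_rpow_measure_univ hq0 hqp hmeas).trans (mul_le_mul' h1 h2)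
  rw [eLpNorm'_eq_lintegral_enorm, hν, lintegral_smul_measure, smul_eq_mul] at h3
  refine h3.trans (le_of_eq ?_)
  rw [← ENNReal.ofReal_coe_nnreal, ← ENNReal.ofReal_mul (NNReal.coe_nonneg C),
    ← ENNReal.ofReal_mul (by positivity)]
  congr 1
  ring

/-- Two numbers that both approximate `f` in the mean near a boundary point are equal. -/
theorem IsLipschitzDomain.eq_of_normalized_setLIntegral_le (hΩ : IsLipschitzDomain Ω)
    {y : EuclideanSpace ℝ (Fin n)} (hy : y ∈ frontier Ω) {a b : ℂ} {α A A' : ℝ} (hα : 0 < α)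
    (hf : AEStronglyMeasurable f (volume.restrict Ω)) (hA : 0 ≤ A) (hA' : 0 ≤ A')
    (ha : ∀ r : ℝ, 0 < r → (ENNReal.ofReal (r ^ n))⁻¹ *
      ∫⁻ x in Metric.ball y r ∩ Ω, ‖f x - a‖ₑ ≤ ENNReal.ofReal (A * r ^ α))
    (hb : ∀ r : ℝ, 0 < r → (ENNReal.ofReal (r ^ n))⁻¹ *
      ∫⁻ x in Metric.ball y r ∩ Ω, ‖f x - b‖ₑ ≤ ENNReal.ofReal (A' * r ^ α)) : a = b := by
  obtain ⟨δ, c, hδ, hc, hvol⟩ := hΩ.exists_volume_ball_inter_ge hy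
  -- The constant |a - b| is averaged over B_r(y) ∩ Ω, of volume at least c r^n; then r tends to 0.
  have key : ∀ r, 0 < r → r ≤ δ → ‖a - b‖ * c ≤ (A + A') * r ^ α := fun r hr hrδ ↦ by
    have h1 : ‖a - b‖ₑ * volume (Metric.ball y r ∩ Ω) ≤
        (∫⁻ x in Metric.ball y r ∩ Ω, ‖f x - b‖ₑ) + ∫⁻ x in Metric.ball y r ∩ Ω, ‖f x - a‖ₑ := by
      have hm : AEMeasurable (fun x ↦ ‖f x - a‖ₑ) (volume.restrict (Metric.ball y r ∩ Ω)) :=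
        ((hf.mono_measure (Measure.restrict_mono Set.inter_subset_right le_rfl)).sub
          aestronglyMeasurable_const).enorm
      rw [← setLIntegral_const, ← lintegral_add_right' _ hm]
      refine lintegral_mono fun x ↦ ?_
      have : a - b = (f x - b) - (f x - a) := by ring
      rw [this]
      exact enorm_sub_le
    have hrn : 0 < r ^ n := by positivity
    have h2 : ‖a - b‖ₑ * ENNReal.ofReal c ≤ ENNReal.ofReal ((A + A') * r ^ α) := by
      calc ‖a - b‖ₑ * ENNReal.ofReal c =
            (ENNReal.ofReal (r ^ n))⁻¹ * (‖a - b‖ₑ * ENNReal.ofReal (c * r ^ n)) := by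
            rw [ENNReal.ofReal_mul hc.le, ← mul_assoc ‖a - b‖ₑ, mul_comm (ENNReal.ofReal (r ^ n))⁻¹,
              mul_assoc (‖a - b‖ₑ * _), ENNReal.mul_inv_cancel (by simpa using hrn)
                ENNReal.ofReal_ne_top, mul_one]
        _ ≤ (ENNReal.ofReal (r ^ n))⁻¹ * ((∫⁻ x in Metric.ball y r ∩ Ω, ‖f x - b‖ₑ) +
              ∫⁻ x in Metric.ball y r ∩ Ω, ‖f x - a‖ₑ) := by
            gcongr
            exact (mul_le_mul_right (hvol r hr hrδ) _).trans h1
        _ ≤ ENNReal.ofReal (A' * r ^ α) + ENNReal.ofReal (A * r ^ α) := by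
            rw [mul_add]
            exact add_le_add (hb r hr) (ha r hr)
        _ = _ := by
            rw [← ENNReal.ofReal_add (by positivity) (by positivity)]
            congr 1
            ring
    rw [← ofReal_norm, ← ENNReal.ofReal_mul (norm_nonneg _)] at h2
    exact (ENNReal.ofReal_le_ofReal_iff (by positivity)).1 h2
  have hlim : Tendsto (fun r : ℝ ↦ (A + A') * r ^ α) (𝓝[>] 0) (𝓝 0) := by
    have : Tendsto (fun r : ℝ ↦ (A + A') * r ^ α) (𝓝[>] 0) (𝓝 ((A + A') * 0 ^ α)) :=
      ((Real.continuousAt_rpow_const 0 α (Or.inr hα.le)).tendsto.mono_left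
        nhdsWithin_le_nhds).const_mul _
    rwa [Real.zero_rpow hα.ne', mul_zero] at this
  have h0 : ‖a - b‖ * c ≤ 0 := ge_of_tendsto hlim (by
    filter_upwards [Ioc_mem_nhdsGT hδ] with r hr using key r hr.1 hr.2)
  have h1 : ‖a - b‖ ≤ 0 := by
    by_contra hcon
    exact absurd h0 (not_le.2 (mul_pos (not_le.1 hcon) hc))
  exact sub_eq_zero.1 (norm_le_zero_iff.1 h1)

theorem ae_boundaryMeasure_of_locally {Q : EuclideanSpace ℝ (Fin n) → Prop}
    (h : ∀ y ∈ frontier Ω, ∃ δ : ℝ, 0 < δ ∧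
      ∀ᵐ x ∂((boundaryMeasure Ω).restrict (Metric.ball y δ)), Q x) :
    ∀ᵐ y ∂(boundaryMeasure Ω), Q y := by
  have hfr : ∀ᵐ y ∂(boundaryMeasure Ω), y ∈ frontier Ω :=
    ae_restrict_mem isClosed_frontier.measurableSet
  have hnull : boundaryMeasure Ω ({y | ¬ Q y} ∩ frontier Ω) = 0 := by
    refine measure_null_of_locally_null _ fun y hy ↦ ?_
    obtain ⟨δ, hδ, hQ⟩ := h y hy.2
    refine ⟨Metric.ball y δ ∩ ({y | ¬ Q y} ∩ frontier Ω),
      inter_mem (mem_nhdsWithin_of_mem_nhds (Metric.ball_mem_nhds y hδ)) self_mem_nhdsWithin, ?_⟩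
    rw [ae_iff, Measure.restrict_apply' Metric.isOpen_ball.measurableSet] at hQ
    exact measure_mono_null (t := {x | ¬ Q x} ∩ Metric.ball y δ) (fun x hx ↦ ⟨hx.2.1, hx.1⟩) hQ
  have : ∀ᵐ y ∂(boundaryMeasure Ω), y ∉ {y | ¬ Q y} ∩ frontier Ω := measure_eq_zero_iff_ae_notMem.1 hnull
  filter_upwards [hfr, this] with y h1 h2
  by_contra hQ
  exact h2 ⟨hQ, h1⟩

theorem MemBesov.ae_boundaryMeasure_exists_weightedPow_le (hΩ : IsLipschitzDomain Ω)
    (hu : MemBesov P s p u) (hp : 0 < p) :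
    ∀ᵐ y ∂(boundaryMeasure Ω), ∃ B : ℝ≥0∞, B < ⊤ ∧
      ∀ k : ℕ, ENNReal.ofReal (((2 : ℝ) ^ k) ^ ((s - 1 / p) * p)) *
        weightedPow p ((2 : ℝ) ^ k)⁻¹ (P.proj k u) y ≤ B := by
  refine ae_boundaryMeasure_of_locally fun y hy ↦ ?_
  cases n with
  -- In dimension 0 there is no unit vector ν, so the boundary is empty.
  | zero =>
    obtain ⟨-, ν, -, -, -, hν, -⟩ := hΩ.graph y hy
    simp [Subsingleton.elim ν 0] at hν
  | succ m =>
    obtain ⟨δ, C, hδ, hC, hball⟩ := hΩ.exists_boundaryMeasure_ball_le hy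
    refine ⟨δ, hδ, ?_⟩
    -- Localising makes the Hausdorff measure finite, as Tonelli requires.
    have : IsFiniteMeasure ((boundaryMeasure Ω).restrict (Metric.ball y δ)) := ⟨by
      have h1 := hball y δ hδ
      rw [Measure.restrict_apply_self] at h1
      rw [Measure.restrict_apply_univ]
      exact h1.trans_lt ENNReal.ofReal_lt_top⟩
    exact hu.ae_exists_weightedPow_le hp hC hball

end BoundaryValues

theorem theorem2 {n : ℕ} (Ω : Set (EuclideanSpace ℝ (Fin n))) (hΩ : IsLipschitzDomain Ω)
    (P : LittlewoodPaley n) (s p : ℝ) (hp : 1 < p) (hs : 1 / p < s) (hs' : s < 1 + 1 / p)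
    (f : EuclideanSpace ℝ (Fin n) → ℂ) (hf : MemBesovOn P s p Ω f) :
    ∃ fb : EuclideanSpace ℝ (Fin n) → ℂ,
      (∀ u : 𝓢'(EuclideanSpace ℝ (Fin n), ℂ), MemBesov P s p u → IsRestriction Ω u f →
        ∀ᵐ y ∂(boundaryMeasure Ω), Tendsto (fun K ↦ P.projLE K u y) atTop (𝓝 (fb y))) ∧
      ∀ α : ℝ, 0 ≤ α → α < s - 1 / p →
        ∀ᵐ y ∂(boundaryMeasure Ω), ∃ C : ℝ, ∀ r : ℝ, 0 < r → r ≤ 1 →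
          ∀ q : ℝ, 1 ≤ q → q ≤ p →
            ((ENNReal.ofReal (r ^ n))⁻¹ *
              ∫⁻ x in Metric.ball y r ∩ Ω, ‖f x - fb y‖ₑ ^ q) ^ (1 / q)
                ≤ ENNReal.ofReal (C * r ^ α) := by
  have hp0 : 0 < p := one_pos.trans hp
  obtain ⟨u₀, hu₀, hf₀⟩ := hf
  refine ⟨fun y ↦ ∑' k, P.proj k u₀ y, fun u hu hfu ↦ ?_, fun α hα hα' ↦ ?_⟩
  · filter_upwards [hu.ae_boundaryMeasure_exists_weightedPow_le hΩ hp0,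
      hu₀.ae_boundaryMeasure_exists_weightedPow_le hΩ hp0,
      (ae_restrict_mem isClosed_frontier.measurableSet :
        ∀ᵐ y ∂(boundaryMeasure Ω), y ∈ frontier Ω)] with y ⟨B, hB, hW⟩ ⟨B₀, hB₀, hW₀⟩ hy
    have hg := hu.memLp_proj ((one_div_pos.2 hp0).trans hs) hp0
    -- Uniqueness needs some positive rate of approximation; half of the admissible range serves.
    have hβ : 0 < (s - 1 / p) / 2 := by linarith
    obtain ⟨C, hC, hle⟩ := exists_normalized_setLIntegral_le hΩ.isOpen hp hs hs' hu hfu hB hW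
      hβ.le (by linarith)
    obtain ⟨C₀, hC₀, hle₀⟩ := exists_normalized_setLIntegral_le hΩ.isOpen hp hs hs' hu₀ hf₀ hB₀ hW₀
      hβ.le (by linarith)
    have heq : ∑' k, P.proj k u y = ∑' k, P.proj k u₀ y :=
      hΩ.eq_of_normalized_setLIntegral_le hy hβ
        hfu.1.aestronglyMeasurable hC hC₀
        (fun r hr ↦ by simpa using hle r hr 1 le_rfl hp.le)
        (fun r hr ↦ by simpa using hle₀ r hr 1 le_rfl hp.le)
    rw [← heq]
    -- `projLE` includes the piece k = K, so the partial sums are shifted by one.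
    exact (P.summable_proj_of_weightedPow_le hp hs hg hB hW).hasSum.tendsto_sum_nat.comp
      (tendsto_add_atTop_nat 1)
  · filter_upwards [hu₀.ae_boundaryMeasure_exists_weightedPow_le hΩ hp0] with y ⟨B, hB, hW⟩
    obtain ⟨C, -, hC⟩ := exists_normalized_setLIntegral_le hΩ.isOpen hp hs hs' hu₀ hf₀ hB hW hα hα'
    exact ⟨C, fun r hr _ ↦ hC r hr⟩
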